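/- Let $d$ be a natural number and let $\mathcal{P}(\mathbb{R}^d)$ be the space of Borel probability measures on $\mathbb{R}^d$ with the topology of weak convergence. A function $\frac{\delta F}{\delta m}:\mathcal{P}(\mathbb{R}^d)\times\mathbb{R}^d\to\mathbb{R}$, measurable in its second variable, is a flat derivative of $F:\mathcal{P}(\mathbb{R}^d)\to\mathbb{R}$ if $m\mapsto\frac{\delta F}{\delta m}(m,x)$ is continuous for every $x$, $x\mapsto\frac{\delta F}{\delta m}(m,x)$ is bounded for every $m$, and for all $m,m'\in\mathcal{P}(\mathbb{R}^d)$ $$F(m')-F(m)=\int_0^1\int_{\mathbb{R}^d}\frac{\delta F}{\delta m}\big(m+\lambda(m'-m),x\big)\,(m'-m)(dx)\,d\lambda .$$ Suppose that $F:\mathcal{P}(\mathbb{R}^d)\to\mathbb{R}$ has a flat derivative $\frac{\delta F}{\delta m}$, normalised by $\int\frac{\delta F}{\delta m}(m,x)\,m(dx)=0$ for all $m$, and a second order flat derivative $\frac{\delta^2F}{\delta m^2}$ (that is, for every $x$ the function $(m,y)\mapsto\frac{\delta^2F}{\delta m^2}(m,x,y)$ is a flat derivative of $m\mapsto\frac{\delta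 F}{\delta m}(m,x)$), and that there are constants $C,C_2>0$ such that for all $m,m'\in\mathcal{P}(\mathbb{R}^d)$ and $x,y\in\mathbb{R}^d$ $$F(m)-F(m')\le\int_{\mathbb{R}^d}\frac{\delta F}{\delta m}(m,x)\,(m-m')(dx),\qquad \Big|\frac{\delta F}{\delta m}(m,x)\Big|\le C,\qquad \Big|\frac{\delta^2F}{\delta m^2}(m,x,y)\Big|\le C_2 .$$ Let $\sigma>0$, let $\pi$ be a probability measure with density $\pi(x)=Z^{-1}e^{-U(x)}$, where $U:\mathbb{R}^d\to\mathbb{R}$ and $Z>0$, and let $m_0$ be an absolutely continuous probability measure with density $m_0(x)$ such that $\sup_{x}\frac{m_0(x)}{\pi(x)}\le R$ for some constant $R>1$. For an absolutely continuous probability measure $m$ with $\operatorname{KL}(m|\pi)<\infty$ put $$a(m,x):=\frac{\delta F}{\delta m}(m,x)+\frac{\sigma^2}{2}\log\frac{m(x)}{\pi(x)}-\frac{\sigma^2}{2}\operatorname{KL}(m|\pi).$$ Then the birth–death equation $$\partial_t m_t(x)=-a(m_t,x)\,m_t(x),\qquad t\ge0,$$ with initial value $m_0$ (with $0\log 0=0$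 and a one-sided derivative at $t=0$) has a solution $(m_t)_{t\ge0}$ consisting of absolutely continuous probability measures with $\operatorname{KL}(m_t|\pi)<\infty$, whose densities satisfy the equation for every $x\in\mathbb{R}^d$ and every $t\ge0$. This solution is unique: every flow of absolutely continuous probability measures with initial value $m_0$ and finite KL-divergence with respect to $\pi$ at all times $t\ge 0$, whose densities, for almost every $x$, satisfy the equation for all $t\ge0$, consists of the same measures $m_t$. Moreover, $$\operatorname{KL}(m_t|\pi)\le2\log R+\frac{4C}{\sigma^2}\qquad\text{for all }t\ge0,$$ and there is a constant $R_1>1$ such that $\sup_{x\in\mathbb{R}^d}\frac{m_t(x)}{\pi(x)}\le R_1$ for all $t\ge0$. If in addition $\inf_{x\in\mathbb{R}^d}\frac{m_0(x)}{\pi(x)}\ge r$ for some constant $r>0$, then there is a constant $r_1>0$ such that $\inf_{x\in\mathbb{R}^d}\frac{m_t(x)}{\pi(x)}\ge r_1$ for all $t\ge0$. -/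

import Mathlib

open MeasureTheory

namespace BirthDeath

/-- The Euclidean space `ℝ^d`. -/
abbrev Space (d : ℕ) := EuclideanSpace ℝ (Fin d)

/-- An absolutely continuous probability measure on `ℝ^d`, given by its density with respect to
Lebesgue measure. -/
structure ProbDensity (d : ℕ) where
  toFun : Space d → ℝ
  measurable_toFun : Measurable toFun
  nonneg : ∀ x, 0 ≤ toFun x
  lintegral_eq_one : ∫⁻ x, ENNReal.ofReal (toFun x) = 1

instance (d : ℕ) : CoeFun (ProbDensity d) (fun _ => Space d → ℝ) := ⟨ProbDensity.toFun⟩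

/-- The probability measure `m(x) dx`. -/
noncomputable def ProbDensity.toMeasure {d : ℕ} (m : ProbDensity d) :
    ProbabilityMeasure (Space d) :=
  ⟨volume.withDensity (fun x => ENNReal.ofReal (m x)), ⟨by
    rw [withDensity_apply _ MeasurableSet.univ, Measure.restrict_univ, m.lintegral_eq_one]⟩⟩

/-- `π(dx) ∝ exp (-U x) dx`. -/
def IsGibbsDensity {d : ℕ} (U : Space d → ℝ) (π : ProbDensity d) : Prop :=
  ∃ Z : ℝ, 0 < Z ∧ ∀ x, π x = Real.exp (-U x) / Z

/-- The mixture `m + l (m' - m)`, `l ∈ [0, 1]`. -/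
noncomputable def mix {d : ℕ} (m m' : ProbabilityMeasure (Space d)) (l : Set.Icc (0 : ℝ) 1) :
    ProbabilityMeasure (Space d) :=
  ⟨ENNReal.ofReal (1 - l) • (m : Measure (Space d)) +
      ENNReal.ofReal l • (m' : Measure (Space d)), ⟨by
    have h1 : (0 : ℝ) ≤ 1 - l := sub_nonneg.2 l.2.2
    simp [← ENNReal.ofReal_add h1 l.2.1]⟩⟩

/-- `D` is a flat (linear functional) derivative of `F` on the space `𝒫(ℝ^d)` of all Borel
probability measures, which carries the topology of weak convergence. -/
structure IsFlatDeriv {d : ℕ} (F : ProbabilityMeasure (Space d) → ℝ)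
    (D : ProbabilityMeasure (Space d) → Space d → ℝ) : Prop where
  measurable : ∀ m, Measurable (D m)
  continuous : ∀ x, Continuous (fun m => D m x)
  bounded : ∀ m, ∃ K : ℝ, 0 < K ∧ ∀ x, |D m x| ≤ K
  integral_eq : ∀ m m', F m' - F m =
    ∫ l in (0 : ℝ)..1,
      ((∫ x, D (mix m m' (Set.projIcc 0 1 zero_le_one l)) x ∂(m' : Measure (Space d))) -
        ∫ x, D (mix m m' (Set.projIcc 0 1 zero_le_one l)) x ∂(m : Measure (Space d)))

/-- `KL(m|π)` with values in `[0, ∞]`. -/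
noncomputable def KL {d : ℕ} (m π : ProbDensity d) : ENNReal :=
  InformationTheory.klDiv (m.toMeasure : Measure (Space d)) (π.toMeasure : Measure (Space d))

/-- `a(m, x) = δF/δm(m, x) + σ²/2 log (m(x)/π(x)) - σ²/2 KL(m|π)`
(meaningful when `KL(m|π) < ∞`). -/
noncomputable def rate {d : ℕ} (D : ProbabilityMeasure (Space d) → Space d → ℝ) (σ : ℝ)
    (π m : ProbDensity d) (x : Space d) : ℝ :=
  D m.toMeasure x + σ ^ 2 / 2 * Real.log (m x / π x) - σ ^ 2 / 2 * (KL m π).toReal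

/-- The flow `(m_t)_{t ≥ 0}` satisfies `∂_t m_t(x) = - a(m_t, x) m_t(x)` at the point `x`, for all
`t ≥ 0` (with the one-sided derivative at `t = 0`). Where `m_t(x) = 0` the right-hand side is `0`,
in accordance with `0 log 0 = 0`. -/
def SolvesAt {d : ℕ} (D : ProbabilityMeasure (Space d) → Space d → ℝ) (σ : ℝ)
    (π : ProbDensity d) (m : ℝ → ProbDensity d) (x : Space d) : Prop :=
  ∀ t : ℝ, 0 ≤ t →
    HasDerivWithinAt (fun s => m s x) (-(rate D σ π (m t) x) * m t x) (Set.Ici 0) t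

end BirthDeath

namespace BirthDeath

open Filter Topology
open scoped ENNReal

variable {d : ℕ}

namespace ProbDensity

theorem ext_toFun {m m' : ProbDensity d} (h : ∀ x, m x = m' x) : m = m' := by
  cases m; cases m'
  congr
  exact funext h

theorem integrable (m : ProbDensity d) : Integrable m.toFun :=
  (lintegral_ofReal_ne_top_iff_integrable m.measurable_toFun.aestronglyMeasurable
    (ae_of_all _ m.nonneg)).1 (by simp [m.lintegral_eq_one])

theorem integral_eq_one (m : ProbDensity d) : ∫ x, m x = 1 := by
  rw [integral_eq_lintegral_of_nonneg_ae (ae_of_all _ m.nonneg)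
    m.measurable_toFun.aestronglyMeasurable, m.lintegral_eq_one, ENNReal.toReal_one]

theorem coe_toMeasure (m : ProbDensity d) : (m.toMeasure : Measure (Space d)) =
    volume.withDensity (fun x => ENNReal.ofReal (m x)) := rfl

theorem toMeasure_eq_of_ae {m m' : ProbDensity d} (h : ∀ᵐ x, m x = m' x) :
    m.toMeasure = m'.toMeasure := by
  apply Subtype.ext
  change (m.toMeasure : Measure (Space d)) = m'.toMeasure
  rw [coe_toMeasure, coe_toMeasure]
  exact withDensity_congr_ae (h.mono fun x hx => by simp only [hx])

theorem ae_eq_of_toMeasure_eq {m m' : ProbDensity d} (h : m.toMeasure = m'.toMeasure) :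
    ∀ᵐ x, m x = m' x := by
  have h1 : (m.toMeasure : Measure (Space d)) = m'.toMeasure := by rw [h]
  rw [coe_toMeasure, coe_toMeasure] at h1
  have h2 := (withDensity_eq_iff m.measurable_toFun.ennreal_ofReal.aemeasurable
    m'.measurable_toFun.ennreal_ofReal.aemeasurable (by simp [m.lintegral_eq_one])).1 h1
  filter_upwards [h2] with x hx
  exact (ENNReal.ofReal_eq_ofReal_iff (m.nonneg x) (m'.nonneg x)).1 hx

theorem integral_toMeasure (m : ProbDensity d) (f : Space d → ℝ) :
    ∫ x, f x ∂(m.toMeasure : Measure (Space d)) = ∫ x, m x * f x := by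
  rw [coe_toMeasure, integral_withDensity_eq_integral_toReal_smul
    m.measurable_toFun.ennreal_ofReal (by simp)]
  simp [ENNReal.toReal_ofReal, m.nonneg]

theorem exists_pos (m : ProbDensity d) {p : Space d → Prop} (hp : ∀ᵐ x, p x) :
    ∃ x, p x ∧ 0 < m x := by
  by_contra! h
  have h0 : ∀ᵐ x, m x = 0 := hp.mono fun x hx => le_antisymm (h x hx) (m.nonneg x)
  have := m.integral_eq_one
  rw [integral_congr_ae h0] at this
  simp at this

theorem integrable_mul_of_bounded (m : ProbDensity d) {f : Space d → ℝ} (hf : Measurable f)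
    {K : ℝ} (hK : ∀ x, |f x| ≤ K) : Integrable (fun x => m x * f x) :=
  m.integrable.mul_bdd (c := K) hf.aestronglyMeasurable (ae_of_all _ hK)

/-- A flow of densities which is continuous in time almost everywhere in space is weakly
continuous. -/
theorem continuous_toMeasure {m : ℝ → ProbDensity d}
    (hm : ∀ᵐ x, Continuous (fun t => m t x)) : Continuous (fun t => (m t).toMeasure) := by
  rw [continuous_iff_seqContinuous]
  intro u t hu
  apply tendsto_of_forall_isOpen_le_liminf'
  intro G hG
  simp only [Function.comp, coe_toMeasure, withDensity_apply _ hG.measurableSet]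
  refine le_trans (le_of_eq ?_) (lintegral_liminf_le
    (fun n => (m (u n)).measurable_toFun.ennreal_ofReal))
  refine lintegral_congr_ae (ae_restrict_of_ae ?_)
  filter_upwards [hm] with x hx
  exact (((ENNReal.continuous_ofReal.comp hx).tendsto t).comp hu).liminf_eq.symm

theorem withDensity_div {π m : ProbDensity d} (hπ : ∀ x, 0 < π x) :
    (m.toMeasure : Measure (Space d)) = (π.toMeasure : Measure (Space d)).withDensity
      (fun x => ENNReal.ofReal (m x / π x)) := by
  rw [coe_toMeasure, coe_toMeasure, ← withDensity_mul _ π.measurable_toFun.ennreal_ofReal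
    (f := fun x => ENNReal.ofReal (π x)) (g := fun x => ENNReal.ofReal (m x / π x))
    (m.measurable_toFun.div π.measurable_toFun).ennreal_ofReal]
  congr 1
  ext x
  rw [Pi.mul_apply, ← ENNReal.ofReal_mul (hπ x).le, mul_div_cancel₀ _ (hπ x).ne']

theorem absolutelyContinuous {π m : ProbDensity d} (hπ : ∀ x, 0 < π x) :
    (m.toMeasure : Measure (Space d)) ≪ π.toMeasure := by
  rw [withDensity_div hπ]
  exact withDensity_absolutelyContinuous _ _

theorem llr_ae_eq {π m : ProbDensity d} (hπ : ∀ x, 0 < π x) :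
    llr (m.toMeasure : Measure (Space d)) π.toMeasure
      =ᵐ[(m.toMeasure : Measure (Space d))] fun x => Real.log (m x / π x) := by
  apply (absolutelyContinuous (m := m) hπ).ae_le
  have h := Measure.rnDeriv_withDensity (π.toMeasure : Measure (Space d))
    (m.measurable_toFun.div π.measurable_toFun).ennreal_ofReal
  filter_upwards [h] with x hx
  have h1 := withDensity_div (m := m) hπ
  rw [llr, h1]
  simp only [Pi.div_apply] at hx
  rw [hx, ENNReal.toReal_ofReal (div_nonneg (m.nonneg x) (hπ x).le)]

theorem KL_toReal {π m : ProbDensity d} (hπ : ∀ x, 0 < π x) :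
    (KL m π).toReal = ∫ x, m x * Real.log (m x / π x) := by
  rw [KL, InformationTheory.toReal_klDiv_of_measure_eq (absolutelyContinuous hπ) (by simp),
    integral_congr_ae (llr_ae_eq hπ), integral_toMeasure]

theorem KL_ne_top {π m : ProbDensity d} (hπ : ∀ x, 0 < π x)
    (h : Integrable (fun x => m x * Real.log (m x / π x))) : KL m π ≠ ⊤ := by
  refine InformationTheory.klDiv_ne_top (absolutelyContinuous hπ) ?_
  rw [integrable_congr (llr_ae_eq hπ), coe_toMeasure,
    integrable_withDensity_iff_integrable_smul' m.measurable_toFun.ennreal_ofReal (by simp)]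
  simpa [ENNReal.toReal_ofReal, m.nonneg] using h

end ProbDensity

theorem IsGibbsDensity.pos {U : Space d → ℝ} {π : ProbDensity d} (h : IsGibbsDensity U π)
    (x : Space d) : 0 < π x := by
  obtain ⟨Z, hZ, h⟩ := h
  rw [h]
  positivity

/-- A functional with a bounded flat derivative is Lipschitz in total variation. -/
theorem IsFlatDeriv.abs_sub_le {F : ProbabilityMeasure (Space d) → ℝ}
    {D : ProbabilityMeasure (Space d) → Space d → ℝ} (hD : IsFlatDeriv F D) {C : ℝ}
    (hC : ∀ m x, |D m x| ≤ C) (m m' : ProbDensity d) :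
    |F m'.toMeasure - F m.toMeasure| ≤ C * ∫ x, |m' x - m x| := by
  rw [hD.integral_eq]
  have key : ∀ μ : ProbabilityMeasure (Space d),
      |(∫ x, D μ x ∂(m'.toMeasure : Measure (Space d))) -
        ∫ x, D μ x ∂(m.toMeasure : Measure (Space d))| ≤ C * ∫ x, |m' x - m x| := by
    intro μ
    rw [m'.integral_toMeasure, m.integral_toMeasure,
      ← integral_sub (m'.integrable_mul_of_bounded (hD.measurable μ) (hC μ))
        (m.integrable_mul_of_bounded (hD.measurable μ) (hC μ)), ← integral_const_mul]
    refine norm_integral_le_of_norm_le (G := ℝ) ((m'.integrable.sub m.integrable).abs.const_mul C)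
      (ae_of_all _ fun x => ?_)
    rw [← sub_mul, Real.norm_eq_abs, abs_mul, mul_comm]
    exact mul_le_mul_of_nonneg_right (hC μ x) (abs_nonneg _)
  have h := intervalIntegral.norm_integral_le_of_norm_le_const (a := 0) (b := 1)
    (f := fun l => (∫ x, D (mix m.toMeasure m'.toMeasure (Set.projIcc 0 1 zero_le_one l)) x
      ∂(m'.toMeasure : Measure (Space d))) -
        ∫ x, D (mix m.toMeasure m'.toMeasure (Set.projIcc 0 1 zero_le_one l)) x
      ∂(m.toMeasure : Measure (Space d))) (C := C * ∫ x, |m' x - m x|) (fun l _ => key _)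
  simpa using h

theorem abs_mul_log_le {u : ℝ} (hu : 0 ≤ u) : |u * Real.log u| ≤ 1 + u ^ 2 := by
  rcases hu.eq_or_lt with rfl | h
  · simp
  rcases le_total u 1 with h1 | h1
  · have := Real.abs_log_mul_self_lt u h h1
    rw [mul_comm] at this
    nlinarith
  · rw [abs_of_nonneg (mul_nonneg hu (Real.log_nonneg h1))]
    have := Real.log_le_sub_one_of_pos h
    nlinarith

/-- The probability density proportional to `f` (and `π` if `f` cannot be normalised). -/
noncomputable def normalize (π : ProbDensity d) (f : Space d → ℝ) : ProbDensity d :=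
  open Classical in
  if h : Measurable f ∧ (∀ x, 0 ≤ f x) ∧ 0 < ∫ x, f x then
    { toFun := fun x => f x / ∫ y, f y
      measurable_toFun := h.1.div_const _
      nonneg := fun x => div_nonneg (h.2.1 x) h.2.2.le
      lintegral_eq_one := by
        rw [← ofReal_integral_eq_lintegral_ofReal
          ((Integrable.of_integral_ne_zero h.2.2.ne').div_const _)
          (ae_of_all _ fun x => div_nonneg (h.2.1 x) h.2.2.le), integral_div,
          div_self h.2.2.ne', ENNReal.ofReal_one] }
  else π

theorem normalize_apply (π : ProbDensity d) {f : Space d → ℝ} (hf : Measurable f)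
    (hf0 : ∀ x, 0 ≤ f x) (hpos : 0 < ∫ x, f x) (x : Space d) :
    normalize π f x = f x / ∫ y, f y := by
  rw [normalize, dif_pos ⟨hf, hf0, hpos⟩]

theorem integral_abs_normalize_sub_le (π : ProbDensity d) {f f' : Space d → ℝ}
    (hf : Measurable f) (hf0 : ∀ x, 0 ≤ f x) (hpos : 0 < ∫ x, f x)
    (hf' : Measurable f') (hf0' : ∀ x, 0 ≤ f' x) (hpos' : 0 < ∫ x, f' x) {δ : ℝ}
    (h : ∀ x, f' x ≤ Real.exp δ * f x) (h' : ∀ x, f x ≤ Real.exp δ * f' x) :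
    ∫ x, |normalize π f' x - normalize π f x| ≤ 4 * δ := by
  have hZ : ∫ x, f' x ≤ Real.exp δ * ∫ x, f x := by
    rw [← integral_const_mul]
    exact integral_mono (Integrable.of_integral_ne_zero hpos'.ne')
      ((Integrable.of_integral_ne_zero hpos.ne').const_mul _) h
  have hZ' : ∫ x, f x ≤ Real.exp δ * ∫ x, f' x := by
    rw [← integral_const_mul]
    exact integral_mono (Integrable.of_integral_ne_zero hpos.ne')
      ((Integrable.of_integral_ne_zero hpos'.ne').const_mul _) h'
  have aux : ∀ {a b Z Y : ℝ}, 0 < Z → 0 < Y → 0 ≤ b → a ≤ Real.exp δ * b →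
      Y ≤ Real.exp δ * Z → a / Z ≤ Real.exp (2 * δ) * (b / Y) := by
    intro a b Z Y hZ hY hb h1 h2
    rw [div_le_iff₀ hZ]
    have : Real.exp (2 * δ) * (b / Y) * Z = (Real.exp δ * b) * ((Real.exp δ * Z) / Y) := by
      rw [two_mul, Real.exp_add]; ring
    rw [this]
    exact h1.trans (le_mul_of_one_le_right (by positivity) ((one_le_div hY).2 h2))
  have aux2 : ∀ {p q : ℝ}, 0 ≤ p → 0 ≤ q → p ≤ Real.exp (2 * δ) * q → p - q ≤ 2 * δ * p := by
    intro p q hp hq hpq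
    have h1 : Real.exp (-(2 * δ)) * p ≤ q := by
      rw [Real.exp_neg, inv_mul_le_iff₀ (Real.exp_pos _)]
      exact hpq
    have h2 := Real.add_one_le_exp (-(2 * δ))
    nlinarith
  have hδ : 0 ≤ δ := by
    by_contra! hδ
    have h1 : Real.exp δ < 1 := by simpa using hδ
    have h2 := hZ.trans (mul_le_mul_of_nonneg_left hZ' (Real.exp_pos δ).le)
    nlinarith [mul_lt_mul_of_pos_right h1 hpos', Real.exp_pos δ,
      mul_lt_mul_of_pos_left h1 (Real.exp_pos δ)]
  have hpt : ∀ x, |normalize π f' x - normalize π f x| ≤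
      2 * δ * (normalize π f' x + normalize π f x) := by
    intro x
    have n1 := (normalize π f').nonneg x
    have n2 := (normalize π f).nonneg x
    have h1 : normalize π f' x ≤ Real.exp (2 * δ) * normalize π f x := by
      rw [normalize_apply π hf hf0 hpos, normalize_apply π hf' hf0' hpos']
      exact aux hpos' hpos (hf0 x) (h x) hZ'
    have h2 : normalize π f x ≤ Real.exp (2 * δ) * normalize π f' x := by
      rw [normalize_apply π hf hf0 hpos, normalize_apply π hf' hf0' hpos']
      exact aux hpos hpos' (hf0' x) (h' x) hZ
    have h3 := aux2 n1 n2 h1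
    have h4 := aux2 n2 n1 h2
    rw [abs_le]
    constructor <;> nlinarith [mul_nonneg hδ n1, mul_nonneg hδ n2]
  calc ∫ x, |normalize π f' x - normalize π f x|
      ≤ ∫ x, 2 * δ * (normalize π f' x + normalize π f x) := by
        refine integral_mono (((normalize π f').integrable.sub (normalize π f).integrable).abs)
          (((normalize π f').integrable.add (normalize π f).integrable).const_mul _) hpt
    _ = 4 * δ := by
        rw [integral_const_mul, integral_add (normalize π f').integrable
          (normalize π f).integrable, ProbDensity.integral_eq_one, ProbDensity.integral_eq_one]
        ring

/-- A jointly measurable function on time and space, bounded by `C`. -/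
structure IsBoundedField (C : ℝ) (g : ℝ → Space d → ℝ) : Prop where
  measurable : Measurable (Function.uncurry g)
  bound : ∀ t x, |g t x| ≤ C

/-- The discounted time integral `∫₀ᵗ e^{-κ(t - s)} g_s(x) ds`. -/
noncomputable def drift (κ : ℝ) (g : ℝ → Space d → ℝ) (t : ℝ) (x : Space d) : ℝ :=
  Real.exp (-(κ * t)) * ∫ s in (0 : ℝ)..t, Real.exp (κ * s) * g s x

namespace IsBoundedField

variable {C κ : ℝ} {g h : ℝ → Space d → ℝ}

theorem nonneg (hg : IsBoundedField C g) : 0 ≤ C := (abs_nonneg _).trans (hg.bound 0 0)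

theorem intervalIntegrable (hg : IsBoundedField C g) (κ : ℝ) (x : Space d) (a b : ℝ) :
    IntervalIntegrable (fun s => Real.exp (κ * s) * g s x) volume a b := by
  have h1 : IntervalIntegrable (fun s => Real.exp (κ * s) * C) volume a b :=
    (by fun_prop : Continuous (fun s => Real.exp (κ * s) * C)).intervalIntegrable a b
  refine h1.mono_fun ?_ ?_
  · have : Measurable (fun s => g s x) := hg.measurable.comp (measurable_id.prodMk measurable_const)
    exact (((by fun_prop : Measurable (fun s : ℝ => Real.exp (κ * s))).mul
      this).aestronglyMeasurable)
  · refine ae_of_all _ fun s => ?_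
    simp only [norm_mul, Real.norm_eq_abs]
    exact mul_le_mul_of_nonneg_left ((hg.bound s x).trans (le_abs_self C)) (abs_nonneg _)

theorem measurable_drift (hg : IsBoundedField C g) (κ t : ℝ) : Measurable (drift κ g t) := by
  have hm : StronglyMeasurable (Function.uncurry fun (x : Space d) (s : ℝ) =>
      Real.exp (κ * s) * g s x) :=
    ((by fun_prop : Measurable (fun p : Space d × ℝ => Real.exp (κ * p.2))).mul
      (hg.measurable.comp measurable_swap)).stronglyMeasurable
  unfold drift intervalIntegral
  exact measurable_const.mul ((hm.integral_prod_right.sub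
    hm.integral_prod_right).measurable)

theorem abs_drift_le (hg : IsBoundedField C g) (hκ : 0 < κ) {t : ℝ} (ht : 0 ≤ t) (x : Space d) :
    |drift κ g t x| ≤ C / κ := by
  have h1 : |∫ s in (0 : ℝ)..t, Real.exp (κ * s) * g s x| ≤
      ∫ s in (0 : ℝ)..t, Real.exp (κ * s) * C := by
    refine intervalIntegral.norm_integral_le_of_norm_le (μ := volume) (E := ℝ) ht (ae_of_all _ fun s _ => ?_)
      ((by fun_prop : Continuous (fun s => Real.exp (κ * s) * C)).intervalIntegrable _ _)
    rw [norm_mul, Real.norm_eq_abs, Real.norm_eq_abs, Real.abs_exp]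
    exact mul_le_mul_of_nonneg_left (hg.bound s x) (Real.exp_pos _).le
  have h2 : ∫ s in (0 : ℝ)..t, Real.exp (κ * s) * C = (Real.exp (κ * t) - 1) / κ * C := by
    rw [intervalIntegral.integral_mul_const, intervalIntegral.integral_comp_mul_left _ hκ.ne',
      integral_exp, mul_zero, Real.exp_zero, smul_eq_mul]
    ring
  rw [drift, abs_mul, Real.abs_exp]
  calc Real.exp (-(κ * t)) * |∫ s in (0 : ℝ)..t, Real.exp (κ * s) * g s x|
      ≤ Real.exp (-(κ * t)) * ((Real.exp (κ * t) - 1) / κ * C) :=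
        mul_le_mul_of_nonneg_left (h1.trans_eq h2) (Real.exp_pos _).le
    _ = (1 - Real.exp (-(κ * t))) * (C / κ) := by
        rw [Real.exp_neg]
        field_simp
    _ ≤ C / κ := by
        have := Real.exp_pos (-(κ * t))
        have := div_nonneg hg.nonneg hκ.le
        nlinarith

theorem abs_drift_le_of_abs_le (hg : IsBoundedField C g) (hκ : 0 < κ) {t T : ℝ} (ht : |t| ≤ T)
    (x : Space d) : |drift κ g t x| ≤ Real.exp (κ * T) * (Real.exp (κ * T) * C * T) := by
  have hT := (abs_le.1 ht)
  have hC := hg.nonneg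
  have h1 : ‖∫ s in (0 : ℝ)..t, Real.exp (κ * s) * g s x‖ ≤ Real.exp (κ * T) * C * |t - 0| := by
    refine intervalIntegral.norm_integral_le_of_norm_le_const fun s hs => ?_
    have hs' : s ≤ T := by
      rcases Set.mem_uIoc.1 hs with h | h <;> linarith [h.1, h.2, abs_nonneg t]
    rw [norm_mul, Real.norm_eq_abs, Real.norm_eq_abs, Real.abs_exp]
    gcongr
    exact hg.bound s x
  rw [drift, abs_mul, Real.abs_exp]
  rw [sub_zero, Real.norm_eq_abs] at h1
  have h2 : Real.exp (κ * T) * C * |t| ≤ Real.exp (κ * T) * C * T := by gcongr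
  have h3 : Real.exp (-(κ * t)) ≤ Real.exp (κ * T) := by
    apply Real.exp_le_exp.2
    nlinarith
  exact mul_le_mul h3 (h1.trans h2) (abs_nonneg _) (Real.exp_pos _).le

theorem abs_drift_sub_le (hg : IsBoundedField C g) (hh : IsBoundedField C h) (hκ : 0 < κ)
    {A l : ℝ} (hl : 0 < l) (hA : ∀ t, 0 ≤ t → ∀ x, |g t x - h t x| ≤ A * Real.exp (l * t))
    {t : ℝ} (ht : 0 ≤ t) (x : Space d) :
    |drift κ g t x - drift κ h t x| ≤ A / l * Real.exp (l * t) := by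
  have hA0 : 0 ≤ A := by simpa using (abs_nonneg _).trans (hA 0 le_rfl 0)
  rw [drift, drift, ← mul_sub, ← intervalIntegral.integral_sub (hg.intervalIntegrable κ x 0 t)
    (hh.intervalIntegrable κ x 0 t), ← intervalIntegral.integral_const_mul]
  have h1 : |∫ s in (0 : ℝ)..t, Real.exp (-(κ * t)) *
      (Real.exp (κ * s) * g s x - Real.exp (κ * s) * h s x)| ≤
      ∫ s in (0 : ℝ)..t, A * Real.exp (l * s) := by
    refine intervalIntegral.norm_integral_le_of_norm_le (μ := volume) (E := ℝ) ht (ae_of_all _ fun s hs => ?_)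
      ((by fun_prop : Continuous (fun s => A * Real.exp (l * s))).intervalIntegrable _ _)
    rw [← mul_sub, ← mul_assoc, ← Real.exp_add, norm_mul, Real.norm_eq_abs, Real.norm_eq_abs,
      Real.abs_exp]
    have h2 : Real.exp (-(κ * t) + κ * s) ≤ 1 := Real.exp_le_one_iff.2 (by nlinarith [hs.2])
    exact (mul_le_of_le_one_left (abs_nonneg _) h2).trans (hA s hs.1.le x)
  refine h1.trans ?_
  rw [intervalIntegral.integral_const_mul, intervalIntegral.integral_comp_mul_left _ hl.ne',
    integral_exp]
  simp only [mul_zero, Real.exp_zero, smul_eq_mul]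
  have : 0 ≤ A * l⁻¹ := by positivity
  calc A * (l⁻¹ * (Real.exp (l * t) - 1)) = A * l⁻¹ * (Real.exp (l * t) - 1) := by ring
    _ ≤ A / l * Real.exp (l * t) := by rw [div_eq_mul_inv]; nlinarith

theorem _root_.BirthDeath.hasDerivAt_drift (κ : ℝ) {x : Space d}
    (hc : Continuous (fun s => g s x)) (t : ℝ) :
    HasDerivAt (fun s => drift κ g s x) (g t x - κ * drift κ g t x) t := by
  have h1 : HasDerivAt (fun s => ∫ r in (0 : ℝ)..s, Real.exp (κ * r) * g r x)
      (Real.exp (κ * t) * g t x) t :=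
    (by fun_prop : Continuous (fun s => Real.exp (κ * s) * g s x)).integral_hasStrictDerivAt
      0 t |>.hasDerivAt
  have h2 : HasDerivAt (fun s => Real.exp (-(κ * s))) (Real.exp (-(κ * t)) * (-(κ * 1))) t :=
    ((hasDerivAt_id t).const_mul κ).neg.exp
  refine (h2.mul h1).congr_deriv ?_
  have h3 : Real.exp (-(κ * t)) * (Real.exp (κ * t) * g t x) = g t x := by
    rw [← mul_assoc, ← Real.exp_add]; simp
  rw [h3, drift]
  ring

theorem continuous_drift (hg : IsBoundedField C g) (κ : ℝ) (x : Space d) :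
    Continuous (fun t => drift κ g t x) := by
  unfold drift
  exact (by fun_prop : Continuous fun t => Real.exp (-(κ * t))).mul
    (intervalIntegral.continuous_primitive (fun a b => hg.intervalIntegrable κ x a b) 0)

end IsBoundedField

/-- The unnormalised density `π (m₀ / π) ^ (e^{-κt}) exp (-drift)`. -/
noncomputable def weight (κ : ℝ) (π m₀ : ProbDensity d) (g : ℝ → Space d → ℝ) (t : ℝ)
    (x : Space d) : ℝ :=
  π x * ((m₀ x / π x) ^ Real.exp (-(κ * t)) * Real.exp (-drift κ g t x))

/-- The flow of probability densities generated by the field `g`, constant before time `0`. -/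
noncomputable def flow (κ : ℝ) (π m₀ : ProbDensity d) (g : ℝ → Space d → ℝ) (t : ℝ) :
    ProbDensity d :=
  normalize π (weight κ π m₀ g (max t 0))

section Weight

variable {C κ R : ℝ} {π m₀ : ProbDensity d} {g : ℝ → Space d → ℝ}

theorem measurable_weight (hg : IsBoundedField C g) (κ t : ℝ) :
    Measurable (weight κ π m₀ g t) := by
  unfold weight
  exact π.measurable_toFun.mul (((m₀.measurable_toFun.div π.measurable_toFun).pow_const _).mul
    (hg.measurable_drift κ t).neg.exp)

theorem weight_nonneg (t : ℝ) (x : Space d) : 0 ≤ weight κ π m₀ g t x :=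
  mul_nonneg (π.nonneg x) (mul_nonneg (Real.rpow_nonneg (div_nonneg (m₀.nonneg x) (π.nonneg x)) _)
    (Real.exp_pos _).le)

theorem weight_eq_zero {x : Space d} (hx : m₀ x = 0) (t : ℝ) : weight κ π m₀ g t x = 0 := by
  simp [weight, hx, Real.zero_rpow (Real.exp_pos _).ne']

theorem weight_pos (hπ : ∀ x, 0 < π x) {x : Space d} (hx : 0 < m₀ x) (t : ℝ) :
    0 < weight κ π m₀ g t x :=
  mul_pos (hπ x) (mul_pos (Real.rpow_pos_of_pos (div_pos hx (hπ x)) _) (Real.exp_pos _))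

theorem weight_zero (hπ : ∀ x, 0 < π x) (x : Space d) : weight κ π m₀ g 0 x = m₀ x := by
  simp [weight, drift, mul_div_cancel₀ _ (hπ x).ne']

theorem log_weight_div (hπ : ∀ x, 0 < π x) {x : Space d} (hx : 0 < m₀ x) (t : ℝ) :
    Real.log (weight κ π m₀ g t x / π x) =
      Real.exp (-(κ * t)) * Real.log (m₀ x / π x) - drift κ g t x := by
  have h := div_pos hx (hπ x)
  rw [weight, mul_div_cancel_left₀ _ (hπ x).ne', Real.log_mul (Real.rpow_pos_of_pos h _).ne'
    (Real.exp_pos _).ne', Real.log_rpow h, Real.log_exp, sub_eq_add_neg]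

theorem continuous_weight (hg : IsBoundedField C g) (κ : ℝ) (hπ : ∀ x, 0 < π x) (x : Space d) :
    Continuous (fun t => weight κ π m₀ g t x) := by
  rcases (m₀.nonneg x).eq_or_lt with h | h
  · simp only [weight_eq_zero h.symm]
    exact continuous_const
  · have h1 := hg.continuous_drift κ x
    have h2 := (Real.continuous_const_rpow (div_pos h (hπ x)).ne').comp
      (by fun_prop : Continuous fun t => Real.exp (-(κ * t)))
    unfold weight
    exact continuous_const.mul (h2.mul h1.neg.rexp)

theorem exists_weight_le (hg : IsBoundedField C g) (hκ : 0 < κ) (hπ : ∀ x, 0 < π x)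
    (hR : 1 ≤ R) (hm₀ : ∀ x, m₀ x / π x ≤ R) (T : ℝ) :
    ∃ M, 0 ≤ M ∧ ∀ t, |t| ≤ T → ∀ x, weight κ π m₀ g t x ≤ M * π x := by
  refine ⟨R ^ Real.exp (κ * T) * Real.exp (Real.exp (κ * T) * (Real.exp (κ * T) * C * T)),
    by positivity, fun t ht x => ?_⟩
  rw [weight, mul_comm]
  refine mul_le_mul_of_nonneg_right (mul_le_mul ?_ ?_ (Real.exp_pos _).le (by positivity)) (hπ x).le
  · refine (Real.rpow_le_rpow (div_nonneg (m₀.nonneg x) (hπ x).le) (hm₀ x)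
      (Real.exp_pos _).le).trans (Real.rpow_le_rpow_of_exponent_le hR (Real.exp_le_exp.2 ?_))
    nlinarith [(abs_le.1 ht).1]
  · exact Real.exp_le_exp.2 (by linarith [(abs_le.1 (hg.abs_drift_le_of_abs_le hκ ht x)).1])

theorem weight_le (hg : IsBoundedField C g) (hκ : 0 < κ) (hπ : ∀ x, 0 < π x)
    (hm₀ : ∀ x, m₀ x / π x ≤ R) {t : ℝ} (ht : 0 ≤ t) (x : Space d) :
    weight κ π m₀ g t x ≤ R ^ Real.exp (-(κ * t)) * Real.exp (C / κ) * π x := by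
  have h0 := div_nonneg (m₀.nonneg x) (hπ x).le
  have hR := h0.trans (hm₀ x)
  rw [weight, mul_comm]
  refine mul_le_mul_of_nonneg_right (mul_le_mul ?_ ?_ (Real.exp_pos _).le (by positivity)) (hπ x).le
  · exact Real.rpow_le_rpow h0 (hm₀ x) (Real.exp_pos _).le
  · exact Real.exp_le_exp.2 (by linarith [(abs_le.1 (hg.abs_drift_le hκ ht x)).1])

theorem le_weight (hg : IsBoundedField C g) (hκ : 0 < κ) (hπ : ∀ x, 0 < π x)
    (hm₀ : ∀ x, m₀ x / π x ≤ R) {t : ℝ} (ht : 0 ≤ t) (x : Space d) :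
    R ^ (Real.exp (-(κ * t)) - 1) * Real.exp (-(C / κ)) * m₀ x ≤ weight κ π m₀ g t x := by
  rcases (m₀.nonneg x).eq_or_lt with h | h
  · rw [weight_eq_zero h.symm, ← h, mul_zero]
  have h0 := div_pos h (hπ x)
  have hα : Real.exp (-(κ * t)) - 1 ≤ 0 := by
    have : Real.exp (-(κ * t)) ≤ 1 := Real.exp_le_one_iff.2 (by nlinarith)
    linarith
  have h1 : R ^ (Real.exp (-(κ * t)) - 1) ≤ (m₀ x / π x) ^ (Real.exp (-(κ * t)) - 1) :=
    Real.rpow_le_rpow_of_nonpos h0 (hm₀ x) hα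
  have h2 : (m₀ x / π x) ^ Real.exp (-(κ * t)) =
      (m₀ x / π x) ^ (Real.exp (-(κ * t)) - 1) * (m₀ x / π x) := by
    rw [← Real.rpow_add_one h0.ne', sub_add_cancel]
  have h3 : Real.exp (-(C / κ)) ≤ Real.exp (-drift κ g t x) :=
    Real.exp_le_exp.2 (by linarith [(abs_le.1 (hg.abs_drift_le hκ ht x)).2])
  have h4 : m₀ x = π x * (m₀ x / π x) := (mul_div_cancel₀ _ (hπ x).ne').symm
  calc R ^ (Real.exp (-(κ * t)) - 1) * Real.exp (-(C / κ)) * m₀ x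
      ≤ (m₀ x / π x) ^ (Real.exp (-(κ * t)) - 1) * Real.exp (-drift κ g t x) * m₀ x := by gcongr
    _ = (m₀ x / π x) ^ (Real.exp (-(κ * t)) - 1) * Real.exp (-drift κ g t x) *
        (π x * (m₀ x / π x)) := by rw [← h4]
    _ = weight κ π m₀ g t x := by rw [weight, h2]; ring

theorem integrable_weight (hg : IsBoundedField C g) (hκ : 0 < κ) (hπ : ∀ x, 0 < π x)
    (hR : 1 ≤ R) (hm₀ : ∀ x, m₀ x / π x ≤ R) (t : ℝ) : Integrable (weight κ π m₀ g t) := by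
  obtain ⟨M, -, hM⟩ := exists_weight_le (m₀ := m₀) hg hκ hπ hR hm₀ |t|
  refine (π.integrable.const_mul M).mono' (measurable_weight hg κ t).aestronglyMeasurable
    (ae_of_all _ fun x => ?_)
  rw [Real.norm_eq_abs, abs_of_nonneg (weight_nonneg t x)]
  exact hM t le_rfl x

theorem integral_weight_le (hg : IsBoundedField C g) (hκ : 0 < κ) (hπ : ∀ x, 0 < π x)
    (hR : 1 ≤ R) (hm₀ : ∀ x, m₀ x / π x ≤ R) {t : ℝ} (ht : 0 ≤ t) :
    ∫ x, weight κ π m₀ g t x ≤ R ^ Real.exp (-(κ * t)) * Real.exp (C / κ) := by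
  have := integral_mono (integrable_weight hg hκ hπ hR hm₀ t) (π.integrable.const_mul _)
    (weight_le hg hκ hπ hm₀ ht)
  rwa [integral_const_mul, π.integral_eq_one, mul_one] at this

theorem le_integral_weight (hg : IsBoundedField C g) (hκ : 0 < κ) (hπ : ∀ x, 0 < π x)
    (hR : 1 ≤ R) (hm₀ : ∀ x, m₀ x / π x ≤ R) {t : ℝ} (ht : 0 ≤ t) :
    R ^ (Real.exp (-(κ * t)) - 1) * Real.exp (-(C / κ)) ≤ ∫ x, weight κ π m₀ g t x := by
  have := integral_mono (m₀.integrable.const_mul _) (integrable_weight hg hκ hπ hR hm₀ t)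
    (le_weight hg hκ hπ hm₀ ht)
  rwa [integral_const_mul, m₀.integral_eq_one, mul_one] at this

theorem integral_weight_pos (hg : IsBoundedField C g) (hκ : 0 < κ) (hπ : ∀ x, 0 < π x)
    (hR : 1 ≤ R) (hm₀ : ∀ x, m₀ x / π x ≤ R) {t : ℝ} (ht : 0 ≤ t) :
    0 < ∫ x, weight κ π m₀ g t x :=
  lt_of_lt_of_le (by positivity) (le_integral_weight hg hκ hπ hR hm₀ ht)

theorem flow_apply (hg : IsBoundedField C g) (hκ : 0 < κ) (hπ : ∀ x, 0 < π x)
    (hR : 1 ≤ R) (hm₀ : ∀ x, m₀ x / π x ≤ R) {t : ℝ} (ht : 0 ≤ t) (x : Space d) :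
    flow κ π m₀ g t x = weight κ π m₀ g t x / ∫ y, weight κ π m₀ g t y := by
  rw [flow, max_eq_left ht, normalize_apply π (measurable_weight hg κ t) (weight_nonneg t)
    (integral_weight_pos hg hκ hπ hR hm₀ ht)]

theorem flow_max (t : ℝ) : flow κ π m₀ g (max t 0) = flow κ π m₀ g t := by
  rw [flow, flow, max_assoc, max_self]

theorem flow_zero (hg : IsBoundedField C g) (hκ : 0 < κ) (hπ : ∀ x, 0 < π x)
    (hR : 1 ≤ R) (hm₀ : ∀ x, m₀ x / π x ≤ R) : flow κ π m₀ g 0 = m₀ := by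
  refine ProbDensity.ext_toFun fun x => ?_
  rw [flow_apply hg hκ hπ hR hm₀ le_rfl]
  simp only [weight_zero hπ, m₀.integral_eq_one, div_one]

theorem flow_div_le (hg : IsBoundedField C g) (hκ : 0 < κ) (hπ : ∀ x, 0 < π x)
    (hR : 1 ≤ R) (hm₀ : ∀ x, m₀ x / π x ≤ R) (t : ℝ) (x : Space d) :
    flow κ π m₀ g t x / π x ≤ R * Real.exp (2 * (C / κ)) := by
  rw [← flow_max]
  have ht : 0 ≤ max t 0 := le_max_right _ _
  set s := max t 0
  have hZ := integral_weight_pos hg hκ hπ hR hm₀ ht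
  rw [flow_apply hg hκ hπ hR hm₀ ht, div_le_iff₀ (hπ x), div_le_iff₀ hZ]
  refine (weight_le hg hκ hπ hm₀ ht x).trans ?_
  have h1 := mul_le_mul_of_nonneg_left (le_integral_weight hg hκ hπ hR hm₀ ht)
    (by have := (hπ x).le; positivity : 0 ≤ R * Real.exp (2 * (C / κ)) * π x)
  refine le_trans (le_of_eq ?_) h1
  have h2 : R ^ Real.exp (-(κ * s)) = R * R ^ (Real.exp (-(κ * s)) - 1) := by
    rw [mul_comm R, ← Real.rpow_add_one (by positivity), sub_add_cancel]
  have h3 : Real.exp (C / κ) = Real.exp (2 * (C / κ)) * Real.exp (-(C / κ)) := by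
    rw [← Real.exp_add]; ring_nf
  rw [h2, h3]
  ring

theorem le_flow_div (hg : IsBoundedField C g) (hκ : 0 < κ) (hπ : ∀ x, 0 < π x)
    (hR : 1 ≤ R) (hm₀ : ∀ x, m₀ x / π x ≤ R) {r : ℝ} (hr : 0 < r) (hr₀ : ∀ x, r ≤ m₀ x / π x)
    (t : ℝ) (x : Space d) :
    min r 1 / (R * Real.exp (2 * (C / κ))) ≤ flow κ π m₀ g t x / π x := by
  rw [← flow_max]
  have ht : 0 ≤ max t 0 := le_max_right _ _
  set s := max t 0
  have hZ := integral_weight_pos hg hκ hπ hR hm₀ ht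
  have hα : Real.exp (-(κ * s)) ≤ 1 := Real.exp_le_one_iff.2 (by nlinarith)
  have hmin : 0 < min r 1 := lt_min hr one_pos
  have h1 : min r 1 ≤ (m₀ x / π x) ^ Real.exp (-(κ * s)) := by
    refine le_trans ?_ (Real.rpow_le_rpow hmin.le ((min_le_left _ _).trans (hr₀ x))
      (Real.exp_pos _).le)
    simpa using Real.rpow_le_rpow_of_exponent_ge hmin (min_le_right r 1) hα
  have h2 : Real.exp (-(C / κ)) ≤ Real.exp (-drift κ g s x) :=
    Real.exp_le_exp.2 (by linarith [(abs_le.1 (hg.abs_drift_le hκ ht x)).2])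
  have h3 : ∫ y, weight κ π m₀ g s y ≤ R * Real.exp (C / κ) :=
    (integral_weight_le hg hκ hπ hR hm₀ ht).trans (mul_le_mul_of_nonneg_right
      (by simpa using Real.rpow_le_rpow_of_exponent_le hR hα) (Real.exp_pos _).le)
  rw [flow_apply hg hκ hπ hR hm₀ ht, div_right_comm, weight, mul_div_cancel_left₀ _ (hπ x).ne']
  calc min r 1 / (R * Real.exp (2 * (C / κ)))
      = (min r 1 * Real.exp (-(C / κ))) / (R * Real.exp (C / κ)) := by
        rw [Real.exp_neg, two_mul, Real.exp_add]
        field_simp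
    _ ≤ _ := div_le_div₀ (mul_nonneg (hmin.le.trans h1) (Real.exp_pos _).le)
        (mul_le_mul h1 h2 (Real.exp_pos _).le (hmin.le.trans h1)) hZ h3

theorem continuous_flow (hg : IsBoundedField C g) (hκ : 0 < κ) (hπ : ∀ x, 0 < π x)
    (hR : 1 ≤ R) (hm₀ : ∀ x, m₀ x / π x ≤ R) (x : Space d) :
    Continuous (fun t => flow κ π m₀ g t x) := by
  have hmax : Continuous fun t : ℝ => max t 0 := by fun_prop
  have hZ : Continuous fun t => ∫ y, weight κ π m₀ g (max t 0) y := by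
    refine continuous_of_dominated (bound := fun y => R * Real.exp (C / κ) * π y)
      (fun t => (measurable_weight hg κ _).aestronglyMeasurable)
      (fun t => ae_of_all _ fun y => ?_) (π.integrable.const_mul _)
      (ae_of_all _ fun y => (continuous_weight hg κ hπ y).comp hmax)
    have ht : 0 ≤ max t 0 := le_max_right _ _
    rw [Real.norm_eq_abs, abs_of_nonneg (weight_nonneg _ y)]
    refine (weight_le hg hκ hπ hm₀ ht y).trans (mul_le_mul_of_nonneg_right
      (mul_le_mul_of_nonneg_right ?_ (Real.exp_pos _).le) (hπ y).le)
    simpa using Real.rpow_le_rpow_of_exponent_le hR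
      (Real.exp_le_one_iff.2 (by nlinarith) : Real.exp (-(κ * max t 0)) ≤ 1)
  have : (fun t => flow κ π m₀ g t x) =
      fun t => weight κ π m₀ g (max t 0) x / ∫ y, weight κ π m₀ g (max t 0) y := by
    ext t
    rw [← flow_max, flow_apply hg hκ hπ hR hm₀ (le_max_right _ _)]
  rw [this]
  exact ((continuous_weight hg κ hπ x).comp hmax).div hZ
    fun t => (integral_weight_pos hg hκ hπ hR hm₀ (le_max_right _ _)).ne'

end Weight

/-- The field seen by the flow that `g` generates. -/
noncomputable def picard (D : ProbabilityMeasure (Space d) → Space d → ℝ) (κ : ℝ)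
    (π m₀ : ProbDensity d) (g : ℝ → Space d → ℝ) (t : ℝ) (x : Space d) : ℝ :=
  D (flow κ π m₀ g t).toMeasure x

section Picard

variable {C C₂ κ R : ℝ} {π m₀ : ProbDensity d} {g h : ℝ → Space d → ℝ}
  {F : ProbabilityMeasure (Space d) → ℝ} {D : ProbabilityMeasure (Space d) → Space d → ℝ}
  {D₂ : ProbabilityMeasure (Space d) → Space d → Space d → ℝ}

/-- The field seen by a weakly continuous flow. -/
theorem IsFlatDeriv.isBoundedField (hD : IsFlatDeriv F D) (hDC : ∀ m x, |D m x| ≤ C)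
    {μ : ℝ → ProbabilityMeasure (Space d)} (hμ : Continuous μ) :
    IsBoundedField C (fun t x => D (μ t) x) where
  measurable := measurable_uncurry_of_continuous_of_measurable
    (fun x => (hD.continuous x).comp hμ) (fun t => hD.measurable (μ t))
  bound _ x := hDC _ x

theorem continuous_picard (hD : IsFlatDeriv F D) (hg : IsBoundedField C g) (hκ : 0 < κ)
    (hπ : ∀ x, 0 < π x) (hR : 1 ≤ R) (hm₀ : ∀ x, m₀ x / π x ≤ R) (x : Space d) :
    Continuous (fun t => picard D κ π m₀ g t x) :=
  (hD.continuous x).comp (ProbDensity.continuous_toMeasure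
    (ae_of_all _ (continuous_flow hg hκ hπ hR hm₀)))

theorem isBoundedField_picard (hD : IsFlatDeriv F D) (hDC : ∀ m x, |D m x| ≤ C)
    (hg : IsBoundedField C g) (hκ : 0 < κ)
    (hπ : ∀ x, 0 < π x) (hR : 1 ≤ R) (hm₀ : ∀ x, m₀ x / π x ≤ R) :
    IsBoundedField C (picard D κ π m₀ g) :=
  hD.isBoundedField hDC (ProbDensity.continuous_toMeasure
    (ae_of_all _ (continuous_flow hg hκ hπ hR hm₀)))

theorem weight_le_exp_mul {δ t : ℝ} {x : Space d}
    (hδ : |drift κ g t x - drift κ h t x| ≤ δ) :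
    weight κ π m₀ g t x ≤ Real.exp δ * weight κ π m₀ h t x := by
  have h1 : Real.exp (-drift κ g t x) ≤ Real.exp δ * Real.exp (-drift κ h t x) := by
    rw [← Real.exp_add]
    exact Real.exp_le_exp.2 (by linarith [(abs_le.1 hδ).1])
  have h2 : 0 ≤ π x * (m₀ x / π x) ^ Real.exp (-(κ * t)) :=
    mul_nonneg (π.nonneg x) (Real.rpow_nonneg (div_nonneg (m₀.nonneg x) (π.nonneg x)) _)
  have h3 := mul_le_mul_of_nonneg_left h1 h2
  rw [weight, weight]
  linarith

/-- The Picard map halves distances in the norm weighted by `e^{-8 C₂ t}`. -/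
theorem picard_contraction (hD₂ : ∀ x, IsFlatDeriv (fun m => D m x) (fun m y => D₂ m x y))
    (hC₂ : 0 < C₂) (hDC₂ : ∀ m x y, |D₂ m x y| ≤ C₂)
    (hg : IsBoundedField C g) (hh : IsBoundedField C h) (hκ : 0 < κ)
    (hπ : ∀ x, 0 < π x) (hR : 1 ≤ R) (hm₀ : ∀ x, m₀ x / π x ≤ R) {A : ℝ}
    (hA : ∀ t, 0 ≤ t → ∀ x, |g t x - h t x| ≤ A * Real.exp (8 * C₂ * t)) {t : ℝ} (ht : 0 ≤ t)
    (x : Space d) :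
    |picard D κ π m₀ g t x - picard D κ π m₀ h t x| ≤ A / 2 * Real.exp (8 * C₂ * t) := by
  have hδ := fun x => hg.abs_drift_sub_le hh hκ (by positivity) hA ht x
  have h1 := (hD₂ x).abs_sub_le (fun m y => hDC₂ m x y) (flow κ π m₀ h t) (flow κ π m₀ g t)
  refine h1.trans ((mul_le_mul_of_nonneg_left (b := ∫ x, |flow κ π m₀ g t x - flow κ π m₀ h t x|)
    (c := 4 * (A / (8 * C₂) * Real.exp (8 * C₂ * t))) ?_ hC₂.le).trans (le_of_eq ?_))
  · rw [flow, flow, max_eq_left ht]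
    exact integral_abs_normalize_sub_le π (measurable_weight hh κ t) (weight_nonneg t)
      (integral_weight_pos hh hκ hπ hR hm₀ ht) (measurable_weight hg κ t) (weight_nonneg t)
      (integral_weight_pos hg hκ hπ hR hm₀ ht) (fun x => weight_le_exp_mul (hδ x))
      (fun x => weight_le_exp_mul (by rw [abs_sub_comm]; exact hδ x))
  · field_simp
    ring

/-- Two fixed points of the Picard map agree. -/
theorem picard_fixed_unique (hD₂ : ∀ x, IsFlatDeriv (fun m => D m x) (fun m y => D₂ m x y))
    (hC₂ : 0 < C₂) (hDC₂ : ∀ m x y, |D₂ m x y| ≤ C₂)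
    (hg : IsBoundedField C g) (hh : IsBoundedField C h) (hκ : 0 < κ)
    (hπ : ∀ x, 0 < π x) (hR : 1 ≤ R) (hm₀ : ∀ x, m₀ x / π x ≤ R)
    (hgf : ∀ t x, picard D κ π m₀ g t x = g t x) (hhf : ∀ t x, picard D κ π m₀ h t x = h t x) :
    g = h := by
  have key : ∀ n : ℕ, ∀ t, 0 ≤ t → ∀ x, |g t x - h t x| ≤
      2 * C / 2 ^ n * Real.exp (8 * C₂ * t) := by
    intro n
    induction n with
    | zero =>
      intro t ht x
      have h1 : |g t x - h t x| ≤ 2 * C :=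
        (abs_sub _ _).trans (by linarith [hg.bound t x, hh.bound t x])
      have h2 : 1 ≤ Real.exp (8 * C₂ * t) := Real.one_le_exp (by positivity)
      have h3 := hg.nonneg
      rw [pow_zero, div_one]
      nlinarith
    | succ n ih =>
      intro t ht x
      have := picard_contraction hD₂ hC₂ hDC₂ hg hh hκ hπ hR hm₀ ih ht x
      rwa [hgf, hhf, div_div, ← pow_succ] at this
  have hpos : ∀ t, 0 ≤ t → ∀ x, g t x = h t x := by
    intro t ht x
    have hlim : Tendsto (fun n : ℕ => 2 * C / 2 ^ n * Real.exp (8 * C₂ * t)) atTop (𝓝 0) := by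
      have := ((tendsto_pow_atTop_nhds_zero_of_lt_one (r := (1 / 2 : ℝ)) (by norm_num)
        (by norm_num)).const_mul (2 * C)).mul_const (Real.exp (8 * C₂ * t))
      simpa [div_eq_mul_inv] using this
    have := ge_of_tendsto' hlim (fun n => key n t ht x)
    exact sub_eq_zero.1 (abs_nonpos_iff.1 this)
  ext t x
  have h1 := hpos _ (le_max_right t 0) x
  rw [← hgf, ← hhf] at h1 ⊢
  simpa only [picard, flow_max] using h1

/-- The Picard map has a fixed point. -/
theorem exists_picard_fixed (hD : IsFlatDeriv F D) (hDC : ∀ m x, |D m x| ≤ C)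
    (hD₂ : ∀ x, IsFlatDeriv (fun m => D m x) (fun m y => D₂ m x y))
    (hC₂ : 0 < C₂) (hDC₂ : ∀ m x y, |D₂ m x y| ≤ C₂) (hC : 0 < C) (hκ : 0 < κ)
    (hπ : ∀ x, 0 < π x) (hR : 1 ≤ R) (hm₀ : ∀ x, m₀ x / π x ≤ R) :
    ∃ g, IsBoundedField C g ∧ ∀ t x, picard D κ π m₀ g t x = g t x := by
  let G : ℕ → ℝ → Space d → ℝ := fun n => (picard D κ π m₀)^[n] (fun _ _ => 0)
  have hG : ∀ n, G (n + 1) = picard D κ π m₀ (G n) := fun n => Function.iterate_succ_apply' _ _ _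
  have hGb : ∀ n, IsBoundedField C (G n) := by
    intro n
    induction n with
    | zero => exact ⟨measurable_const, fun t x => by simpa [G] using hC.le⟩
    | succ n ih =>
      rw [hG]
      exact isBoundedField_picard hD hDC ih hκ hπ hR hm₀
  have hstep : ∀ n : ℕ, ∀ t, 0 ≤ t → ∀ x, |G n t x - G (n + 1) t x| ≤
      C / 2 ^ n * Real.exp (8 * C₂ * t) := by
    intro n
    induction n with
    | zero =>
      intro t ht x
      have h2 : 1 ≤ Real.exp (8 * C₂ * t) := Real.one_le_exp (by positivity)
      have h3 := (hGb 1).bound t x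
      have h4 : G 0 t x = 0 := rfl
      rw [h4, zero_add, zero_sub, abs_neg, pow_zero, div_one]
      nlinarith
    | succ n ih =>
      intro t ht x
      have := picard_contraction hD₂ hC₂ hDC₂ (hGb n) (hGb (n + 1)) hκ hπ hR hm₀ ih ht x
      rwa [← hG, ← hG, div_div, ← pow_succ] at this
  have hstep' : ∀ t, 0 ≤ t → ∀ x, ∀ n, dist (G n t x) (G (n + 1) t x) ≤
      2 * C * Real.exp (8 * C₂ * t) / 2 / 2 ^ n := by
    intro t ht x n
    refine (hstep n t ht x).trans (le_of_eq ?_)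
    ring
  choose! g₀ hg₀ using fun t (ht : 0 ≤ t) (x : Space d) =>
    cauchySeq_tendsto_of_complete (cauchySeq_of_le_geometric_two (hstep' t ht x))
  have hGmax : ∀ n t x, G n (max t 0) x = G n t x := by
    intro n t x
    cases n with
    | zero => rfl
    | succ n => rw [hG]; simp only [picard, flow_max]
  have hlim : ∀ t x, Tendsto (fun n => G n t x) atTop (𝓝 (g₀ (max t 0) x)) := by
    intro t x
    simpa only [hGmax] using hg₀ (max t 0) (le_max_right _ _) x
  let g : ℝ → Space d → ℝ := fun t x => g₀ (max t 0) x
  have hgb : IsBoundedField C g := by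
    refine ⟨measurable_of_tendsto_metrizable (fun n => (hGb n).measurable)
      (tendsto_pi_nhds.2 fun p => hlim p.1 p.2), fun t x => ?_⟩
    exact le_of_tendsto' (hlim t x).abs fun n => (hGb n).bound t x
  have hdist : ∀ n : ℕ, ∀ t, 0 ≤ t → ∀ x, |G n t x - g t x| ≤
      2 * C / 2 ^ n * Real.exp (8 * C₂ * t) := by
    intro n t ht x
    refine (dist_le_of_le_geometric_two_of_tendsto (hstep' t ht x) (hlim t x) n).trans
      (le_of_eq ?_)
    ring
  refine ⟨g, hgb, fun t x => ?_⟩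
  have hpos : ∀ t, 0 ≤ t → ∀ x, picard D κ π m₀ g t x = g t x := by
    intro t ht x
    refine tendsto_nhds_unique ?_ ((tendsto_add_atTop_iff_nat 1).2 (hlim t x))
    rw [tendsto_iff_dist_tendsto_zero]
    refine squeeze_zero (fun _ => dist_nonneg) (g := fun n : ℕ =>
      2 * C / 2 ^ n / 2 * Real.exp (8 * C₂ * t)) (fun n => ?_) ?_
    · rw [hG]
      exact picard_contraction hD₂ hC₂ hDC₂ (hGb n) hgb hκ hπ hR hm₀ (hdist n) ht x
    · have := ((tendsto_pow_atTop_nhds_zero_of_lt_one (r := (1 / 2 : ℝ)) (by norm_num)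
        (by norm_num)).const_mul C).mul_const (Real.exp (8 * C₂ * t))
      refine (this.congr fun n => ?_).trans (by simp)
      rw [one_div, inv_pow]
      ring
  have h1 := hpos _ (le_max_right t 0) x
  simp only [picard, flow_max] at h1
  rw [picard, h1]
  simp only [g, max_assoc, max_self]

end Picard

section Existence

variable {C κ R : ℝ} {π m₀ : ProbDensity d} {g : ℝ → Space d → ℝ}
  {D : ProbabilityMeasure (Space d) → Space d → ℝ}

theorem hasDerivAt_weight (κ : ℝ) (hπ : ∀ x, 0 < π x) {x : Space d}
    (hc : Continuous (fun s => g s x)) (t : ℝ) :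
    HasDerivAt (fun s => weight κ π m₀ g s x)
      (-((κ * Real.log (weight κ π m₀ g t x / π x) + g t x) * weight κ π m₀ g t x)) t := by
  rcases (m₀.nonneg x).eq_or_lt with h | h
  · simp only [weight_eq_zero h.symm, mul_zero, neg_zero]
    exact hasDerivAt_const t 0
  · have hw : ∀ s, weight κ π m₀ g s x =
        π x * Real.exp (Real.exp (-(κ * s)) * Real.log (m₀ x / π x) - drift κ g s x) := by
      intro s
      rw [← log_weight_div hπ h, Real.exp_log (div_pos (weight_pos hπ h s) (hπ x)),
        mul_div_cancel₀ _ (hπ x).ne']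
    have h1 : HasDerivAt (fun s => Real.exp (-(κ * s))) (Real.exp (-(κ * t)) * (-(κ * 1))) t :=
      ((hasDerivAt_id t).const_mul κ).neg.exp
    have h2 := (((h1.mul_const (Real.log (m₀ x / π x))).sub
      (hasDerivAt_drift κ hc t)).exp).const_mul (π x)
    rw [log_weight_div hπ h]
    simp only [hw]
    refine h2.congr_deriv ?_
    simp only [Pi.sub_apply]
    ring

theorem abs_weight_mul_le (hπ : ∀ x, 0 < π x) {M : ℝ} {t : ℝ} {x : Space d}
    (hM : weight κ π m₀ g t x ≤ M * π x) :
    |weight κ π m₀ g t x * Real.log (weight κ π m₀ g t x / π x)| ≤ (1 + M ^ 2) * π x := by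
  have h0 := weight_nonneg (κ := κ) (π := π) (m₀ := m₀) (g := g) t x
  have h1 : weight κ π m₀ g t x / π x ≤ M := (div_le_iff₀ (hπ x)).2 hM
  have h2 := div_nonneg h0 (hπ x).le
  have h3 := abs_mul_log_le h2
  have h4 : weight κ π m₀ g t x * Real.log (weight κ π m₀ g t x / π x) = π x *
      (weight κ π m₀ g t x / π x * Real.log (weight κ π m₀ g t x / π x)) := by
    rw [← mul_assoc, mul_div_cancel₀ _ (hπ x).ne']
  rw [h4, abs_mul, abs_of_pos (hπ x), mul_comm]
  refine mul_le_mul_of_nonneg_right (h3.trans ?_) (hπ x).le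
  gcongr

theorem integrable_weight_mul_log (hg : IsBoundedField C g) (hκ : 0 < κ) (hπ : ∀ x, 0 < π x)
    (hR : 1 ≤ R) (hm₀ : ∀ x, m₀ x / π x ≤ R) (t : ℝ) :
    Integrable (fun x => weight κ π m₀ g t x * Real.log (weight κ π m₀ g t x / π x)) := by
  obtain ⟨M, -, hM⟩ := exists_weight_le (m₀ := m₀) hg hκ hπ hR hm₀ |t|
  have hm := measurable_weight (π := π) (m₀ := m₀) hg κ t
  exact (π.integrable.const_mul (1 + M ^ 2)).mono'
    (hm.mul (hm.div π.measurable_toFun).log).aestronglyMeasurable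
    (ae_of_all _ fun x => abs_weight_mul_le hπ (hM t le_rfl x))

theorem hasDerivAt_integral_weight (hg : IsBoundedField C g)
    (hc : ∀ x, Continuous (fun s => g s x)) (hκ : 0 < κ) (hπ : ∀ x, 0 < π x)
    (hR : 1 ≤ R) (hm₀ : ∀ x, m₀ x / π x ≤ R) (t : ℝ) :
    HasDerivAt (fun s => ∫ x, weight κ π m₀ g s x)
      (-(κ * (∫ x, weight κ π m₀ g t x * Real.log (weight κ π m₀ g t x / π x)) +
        ∫ x, weight κ π m₀ g t x * g t x)) t := by
  obtain ⟨M, hM0, hM⟩ := exists_weight_le (m₀ := m₀) hg hκ hπ hR hm₀ (|t| + 1)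
  have hgm : ∀ s, Measurable (g s) := fun s => hg.measurable.comp
    (measurable_const.prodMk measurable_id)
  have hm := measurable_weight (π := π) (m₀ := m₀) hg κ t
  have hi := integrable_weight hg hκ hπ hR hm₀ t
  have key := hasDerivAt_integral_of_dominated_loc_of_deriv_le (μ := (volume : Measure (Space d)))
    (F := fun s x => weight κ π m₀ g s x)
    (F' := fun s x => -((κ * Real.log (weight κ π m₀ g s x / π x) + g s x) * weight κ π m₀ g s x))
    (bound := fun x => (κ * (1 + M ^ 2) + C * M) * π x) (x₀ := t)
    (Metric.ball_mem_nhds t one_pos)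
    (Eventually.of_forall fun s => (measurable_weight hg κ s).aestronglyMeasurable) hi
    (((((hm.div π.measurable_toFun).log.const_mul κ).add (hgm t)).mul hm).neg.aestronglyMeasurable)
    (ae_of_all _ fun x s hs => ?_) (π.integrable.const_mul _)
    (ae_of_all _ fun x s _ => hasDerivAt_weight κ hπ (hc x) s)
  · have h1 := integrable_weight_mul_log hg hκ hπ hR hm₀ t
    have h2 : Integrable (fun x => weight κ π m₀ g t x * g t x) :=
      hi.mul_bdd (c := C) (hgm t).aestronglyMeasurable (ae_of_all _ (hg.bound t))
    refine key.2.congr_deriv ?_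
    rw [← integral_const_mul, ← integral_add (h1.const_mul κ) h2, ← integral_neg]
    refine integral_congr_ae (ae_of_all _ fun x => ?_)
    simp only
    ring
  · have hs' : |s| ≤ |t| + 1 := by
      rw [Metric.mem_ball, Real.dist_eq] at hs
      have := abs_sub_abs_le_abs_sub s t
      linarith
    have h1 := abs_weight_mul_le hπ (hM s hs' x)
    have h2 := weight_nonneg (κ := κ) (π := π) (m₀ := m₀) (g := g) s x
    have h3 := hM s hs' x
    have h4 := hg.bound s x
    calc ‖-((κ * Real.log (weight κ π m₀ g s x / π x) + g s x) * weight κ π m₀ g s x)‖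
        = |κ * (weight κ π m₀ g s x * Real.log (weight κ π m₀ g s x / π x)) +
          g s x * weight κ π m₀ g s x| := by
          rw [norm_neg, Real.norm_eq_abs]; ring_nf
      _ ≤ κ * |weight κ π m₀ g s x * Real.log (weight κ π m₀ g s x / π x)| +
          |g s x| * weight κ π m₀ g s x := by
          refine (abs_add_le _ _).trans (le_of_eq ?_)
          rw [abs_mul κ, abs_of_pos hκ, abs_mul (g s x), abs_of_nonneg h2]
      _ ≤ κ * ((1 + M ^ 2) * π x) + C * (M * π x) := by
          have := hg.nonneg
          gcongr
      _ = _ := by ring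

theorem flow_mul_log_eq (hg : IsBoundedField C g) (hκ : 0 < κ) (hπ : ∀ x, 0 < π x)
    (hR : 1 ≤ R) (hm₀ : ∀ x, m₀ x / π x ≤ R) {t : ℝ} (ht : 0 ≤ t) (x : Space d) :
    flow κ π m₀ g t x * Real.log (flow κ π m₀ g t x / π x) =
      (weight κ π m₀ g t x * Real.log (weight κ π m₀ g t x / π x)) / (∫ y, weight κ π m₀ g t y) -
        Real.log (∫ y, weight κ π m₀ g t y) * flow κ π m₀ g t x := by
  have hZ := integral_weight_pos hg hκ hπ hR hm₀ ht
  rw [flow_apply hg hκ hπ hR hm₀ ht]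
  rcases (weight_nonneg (κ := κ) (π := π) (m₀ := m₀) (g := g) t x).eq_or_lt with h | h
  · simp [← h]
  · rw [div_right_comm, Real.log_div (div_pos h (hπ x)).ne' hZ.ne']
    ring

theorem KL_flow (hg : IsBoundedField C g) (hκ : 0 < κ) (hπ : ∀ x, 0 < π x)
    (hR : 1 ≤ R) (hm₀ : ∀ x, m₀ x / π x ≤ R) {t : ℝ} (ht : 0 ≤ t) :
    KL (flow κ π m₀ g t) π ≠ ⊤ ∧ (KL (flow κ π m₀ g t) π).toReal =
      (∫ x, weight κ π m₀ g t x * Real.log (weight κ π m₀ g t x / π x)) /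
        (∫ y, weight κ π m₀ g t y) - Real.log (∫ y, weight κ π m₀ g t y) := by
  have h1 := (integrable_weight_mul_log hg hκ hπ hR hm₀ t).div_const
    (∫ y, weight κ π m₀ g t y)
  have h2 := (flow κ π m₀ g t).integrable.const_mul (Real.log (∫ y, weight κ π m₀ g t y))
  have h3 := fun x => flow_mul_log_eq hg hκ hπ hR hm₀ ht x
  constructor
  · apply ProbDensity.KL_ne_top hπ
    simp only [h3]
    exact h1.sub h2
  · rw [ProbDensity.KL_toReal hπ]
    simp only [h3]
    rw [integral_sub h1 h2, integral_div, integral_const_mul, ProbDensity.integral_eq_one, mul_one]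

theorem KL_flow_le (hg : IsBoundedField C g) (hκ : 0 < κ) (hπ : ∀ x, 0 < π x)
    (hR : 1 ≤ R) (hm₀ : ∀ x, m₀ x / π x ≤ R) {t : ℝ} (ht : 0 ≤ t) :
    KL (flow κ π m₀ g t) π ≤ ENNReal.ofReal (Real.log R + 2 * (C / κ)) := by
  have hKL := KL_flow hg hκ hπ hR hm₀ ht
  rw [← ENNReal.ofReal_toReal hKL.1]
  apply ENNReal.ofReal_le_ofReal
  rw [ProbDensity.KL_toReal hπ]
  have hint : Integrable (fun x => flow κ π m₀ g t x *
      Real.log (flow κ π m₀ g t x / π x)) := by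
    simp only [fun x => flow_mul_log_eq hg hκ hπ hR hm₀ ht x]
    exact ((integrable_weight_mul_log hg hκ hπ hR hm₀ t).div_const _).sub
      ((flow κ π m₀ g t).integrable.const_mul _)
  have := integral_mono (g := fun x => flow κ π m₀ g t x * (Real.log R + 2 * (C / κ))) hint
    ((flow κ π m₀ g t).integrable.mul_const _) fun x => by
      have h0 := (flow κ π m₀ g t).nonneg x
      refine mul_le_mul_of_nonneg_left ?_ h0
      have hb := flow_div_le hg hκ hπ hR hm₀ t x
      rcases h0.eq_or_lt with h | h
      · rw [← h, zero_div, Real.log_zero]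
        have := Real.log_nonneg hR
        have := div_nonneg hg.nonneg hκ.le
        linarith
      · refine (Real.log_le_log (div_pos h (hπ x)) hb).trans (le_of_eq ?_)
        rw [Real.log_mul (by positivity) (Real.exp_pos _).ne', Real.log_exp]
  rwa [integral_mul_const, ProbDensity.integral_eq_one, one_mul] at this

/-- A fixed point of the Picard map generates a solution of the birth-death equation. -/
theorem solvesAt_flow (hD_norm : ∀ m : ProbabilityMeasure (Space d),
      ∫ x, D m x ∂(m : Measure (Space d)) = 0) {σ : ℝ} (hσ : 0 < σ)
    (hg : IsBoundedField C g) (hc : ∀ x, Continuous (fun s => g s x))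
    (hfix : ∀ t x, picard D (σ ^ 2 / 2) π m₀ g t x = g t x) (hπ : ∀ x, 0 < π x)
    (hR : 1 ≤ R) (hm₀ : ∀ x, m₀ x / π x ≤ R) (x : Space d) :
    SolvesAt D σ π (flow (σ ^ 2 / 2) π m₀ g) x := by
  intro t ht
  have hκ : 0 < σ ^ 2 / 2 := by positivity
  rw [rate, (KL_flow hg hκ hπ hR hm₀ ht).2]
  have hDg : D (flow (σ ^ 2 / 2) π m₀ g t).toMeasure = g t := funext (hfix t)
  have hnorm := hD_norm (flow (σ ^ 2 / 2) π m₀ g t).toMeasure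
  rw [hDg, ProbDensity.integral_toMeasure] at hnorm
  rw [hDg]
  set κ := σ ^ 2 / 2
  have hZ := integral_weight_pos hg hκ hπ hR hm₀ ht
  have hgW : ∫ x, weight κ π m₀ g t x * g t x = 0 := by
    have h1 : ∀ x, flow κ π m₀ g t x * g t x =
        (weight κ π m₀ g t x * g t x) / ∫ y, weight κ π m₀ g t y := by
      intro x
      rw [flow_apply hg hκ hπ hR hm₀ ht]
      ring
    simp only [h1, integral_div] at hnorm
    rcases div_eq_zero_iff.1 hnorm with h | h
    · exact h
    · exact absurd h hZ.ne'
  have hZ' := hasDerivAt_integral_weight hg hc hκ hπ hR hm₀ t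
  rw [hgW, add_zero] at hZ'
  have h := ((hasDerivAt_weight (m₀ := m₀) κ hπ (hc x) t).div hZ' hZ.ne').hasDerivWithinAt
    (s := Set.Ici 0)
  refine (h.congr (fun s hs => flow_apply hg hκ hπ hR hm₀ hs x)
    (flow_apply hg hκ hπ hR hm₀ ht x)).congr_deriv ?_
  rw [flow_apply hg hκ hπ hR hm₀ ht]
  set Z := ∫ y, weight κ π m₀ g t y
  rcases (weight_nonneg (κ := κ) (π := π) (m₀ := m₀) (g := g) t x).eq_or_lt with h | h
  · simp [← h]
  · rw [div_right_comm, Real.log_div (div_pos h (hπ x)).ne' hZ.ne']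
    field_simp
    ring

end Existence

theorem pos_of_forall_le {f : ℝ → ℝ} {a b δ : ℝ} (hf : ContinuousOn f (Set.Icc a b))
    (ha : 0 < f a) (hδ : 0 < δ)
    (h : ∀ t ∈ Set.Icc a b, (∀ s ∈ Set.Icc a t, 0 < f s) → δ ≤ f t) :
    ∀ t ∈ Set.Icc a b, 0 < f t := by
  by_contra! hcon
  obtain ⟨t₀, ht₀, hft₀⟩ := hcon
  have hcl : IsClosed (Set.Icc a b ∩ f ⁻¹' Set.Iic 0) :=
    hf.preimage_isClosed_of_isClosed isClosed_Icc isClosed_Iic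
  have hbdd : BddBelow (Set.Icc a b ∩ f ⁻¹' Set.Iic 0) := ⟨a, fun s hs => hs.1.1⟩
  obtain ⟨hu, hfu⟩ := hcl.csInf_mem ⟨t₀, ht₀, hft₀⟩ hbdd
  set u := sInf (Set.Icc a b ∩ f ⁻¹' Set.Iic 0)
  have hau : a < u := lt_of_le_of_ne hu.1 fun h => (not_lt.2 (h ▸ hfu)) ha
  have hbelow : ∀ t ∈ Set.Ico a u, δ ≤ f t := by
    intro t ht
    refine h t ⟨ht.1, ht.2.le.trans hu.2⟩ fun s hs => ?_
    by_contra! hs'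
    exact (not_le.2 (hs.2.trans_lt ht.2))
      (csInf_le hbdd ⟨⟨hs.1, hs.2.trans (ht.2.le.trans hu.2)⟩, hs'⟩)
  have hlim : Tendsto f (𝓝[Set.Ico a u] u) (𝓝 (f u)) :=
    (hf u hu).mono_left (nhdsWithin_mono _ fun s hs => ⟨hs.1, hs.2.le.trans hu.2⟩)
  have : (𝓝[Set.Ico a u] u).NeBot := by
    rw [← mem_closure_iff_nhdsWithin_neBot, closure_Ico hau.ne]
    exact ⟨hau.le, le_rfl⟩
  have hge : δ ≤ f u := ge_of_tendsto hlim
    (eventually_nhdsWithin_of_forall hbelow)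
  exact absurd (hge.trans hfu) (not_le.2 hδ)

theorem pos_of_forall_le_backward {f : ℝ → ℝ} {a b δ : ℝ} (hf : ContinuousOn f (Set.Icc a b))
    (hb : 0 < f b) (hδ : 0 < δ)
    (h : ∀ t ∈ Set.Icc a b, (∀ s ∈ Set.Icc t b, 0 < f s) → δ ≤ f t) :
    ∀ t ∈ Set.Icc a b, 0 < f t := by
  have hmaps : ∀ t ∈ Set.Icc a b, a + b - t ∈ Set.Icc a b :=
    fun t ht => ⟨by linarith [ht.2], by linarith [ht.1]⟩
  have key := pos_of_forall_le (f := fun s => f (a + b - s)) (a := a) (b := b)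
    (hf.comp (by fun_prop) hmaps) (by simpa using hb) hδ fun t ht hs =>
      h _ (hmaps t ht) fun s hs' => by
        have := hs (a + b - s) ⟨by linarith [hs'.2], by linarith [hs'.1]⟩
        simpa using this
  intro t ht
  have := key _ (hmaps t ht)
  simpa using this

section Uniqueness

variable {C κ σ : ℝ} {π : ProbDensity d} {m : ℝ → ProbDensity d}
  {D : ProbabilityMeasure (Space d) → Space d → ℝ}

theorem SolvesAt.continuousOn {x : Space d} (h : SolvesAt D σ π m x) :
    ContinuousOn (fun t => m t x) (Set.Ici 0) :=
  fun t ht => (h t ht).continuousWithinAt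

theorem SolvesAt.hasDerivWithinAt_log {x : Space d} (h : SolvesAt D σ π m x)
    (hπ : ∀ x, 0 < π x) {t : ℝ} (ht : 0 ≤ t) (hpos : 0 < m t x) :
    HasDerivWithinAt (fun s => Real.log (m s x / π x)) (-rate D σ π (m t) x) (Set.Ici 0) t := by
  refine (((h t ht).div_const (π x)).log (div_pos hpos (hπ x)).ne').congr_deriv ?_
  have := (hπ x).ne'
  field_simp

theorem SolvesAt.pos {x : Space d} (h : SolvesAt D σ π m x) (hσ : 0 < σ)
    (hDC : ∀ m x, |D m x| ≤ C) (hπ : ∀ x, 0 < π x) (h0 : 0 < m 0 x) {t : ℝ} (ht : 0 ≤ t) :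
    0 < m t x := by
  have hκ : 0 < σ ^ 2 / 2 := by positivity
  set κ := σ ^ 2 / 2 with hκ_def
  have hE := fun s : ℝ => (((hasDerivAt_id s).const_mul κ).exp).hasDerivWithinAt (s := Set.Ici 0)
  refine pos_of_forall_le (δ := Real.exp (-|Real.log (m 0 x / π x) + C / κ| - C / κ) * π x)
    (h.continuousOn.mono fun s (hs : s ∈ Set.Icc 0 t) => hs.1) h0
    (mul_pos (Real.exp_pos _) (hπ x)) (fun b hb hpos => ?_) t ⟨ht, le_rfl⟩
  let q : ℝ → ℝ := fun s => Real.exp (κ * s) * (Real.log (m s x / π x) + C / κ)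
  have hq : ∀ s ∈ Set.Icc 0 b, HasDerivWithinAt q
      (Real.exp (κ * s) * (C - D (m s).toMeasure x + κ * (KL (m s) π).toReal)) (Set.Ici 0) s := by
    intro s hs
    refine ((hE s).mul ((h.hasDerivWithinAt_log hπ hs.1 (hpos s hs)).add_const
      (C / κ))).congr_deriv ?_
    simp only [rate, ← hκ_def, id]
    field_simp
    ring
  have hmono : MonotoneOn q (Set.Icc 0 b) := by
    refine monotoneOn_of_hasDerivWithinAt_nonneg (convex_Icc 0 b)
      (fun s hs => (hq s hs).continuousWithinAt.mono fun r hr => hr.1)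
      (fun s hs => (hq s (interior_subset hs)).mono fun r hr => (interior_subset hr).1)
      fun s hs => mul_nonneg (Real.exp_pos _).le ?_
    have h1 := (abs_le.1 (hDC (m s).toMeasure x)).2
    have h2 : 0 ≤ (KL (m s) π).toReal := ENNReal.toReal_nonneg
    nlinarith [mul_nonneg hκ.le h2]
  have h1 := hmono ⟨le_rfl, hb.1⟩ ⟨hb.1, le_rfl⟩ hb.1
  simp only [q, mul_zero, Real.exp_zero, one_mul] at h1
  have h2 : Real.log (m 0 x / π x) + C / κ = Real.exp (κ * b) *
      (Real.exp (-(κ * b)) * (Real.log (m 0 x / π x) + C / κ)) := by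
    rw [← mul_assoc, ← Real.exp_add]
    simp
  rw [h2] at h1
  have h3 := le_of_mul_le_mul_left h1 (Real.exp_pos _)
  have h4 : Real.exp (-(κ * b)) ≤ 1 := Real.exp_le_one_iff.2 (by nlinarith [hb.1])
  have h5 : -|Real.log (m 0 x / π x) + C / κ| ≤
      Real.exp (-(κ * b)) * (Real.log (m 0 x / π x) + C / κ) := by
    nlinarith [neg_abs_le (Real.log (m 0 x / π x) + C / κ), Real.exp_pos (-(κ * b)),
      abs_nonneg (Real.log (m 0 x / π x) + C / κ)]
  rw [← le_div_iff₀ (hπ x), ← Real.le_log_iff_exp_le (div_pos (hpos b ⟨hb.1, le_rfl⟩) (hπ x))]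
  linarith

/-- The divergence term cancels in the difference of the logarithms at two points. -/
theorem SolvesAt.log_sub_log_eq {x z : Space d} (hx : SolvesAt D σ π m x)
    (hz : SolvesAt D σ π m z) (hπ : ∀ x, 0 < π x) {g : ℝ → Space d → ℝ}
    (hc : ∀ x, Continuous (fun s => g s x))
    (hgD : ∀ t, 0 ≤ t → ∀ x, g t x = D (m t).toMeasure x) {a b : ℝ} (ha : 0 ≤ a) (hab : a ≤ b)
    (hxpos : ∀ s ∈ Set.Icc a b, 0 < m s x) (hzpos : ∀ s ∈ Set.Icc a b, 0 < m s z) :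
    Real.exp (σ ^ 2 / 2 * b) * (Real.log (m b x / π x) - Real.log (m b z / π z) +
      drift (σ ^ 2 / 2) g b x - drift (σ ^ 2 / 2) g b z) =
    Real.exp (σ ^ 2 / 2 * a) * (Real.log (m a x / π x) - Real.log (m a z / π z) +
      drift (σ ^ 2 / 2) g a x - drift (σ ^ 2 / 2) g a z) := by
  set κ := σ ^ 2 / 2 with hκ_def
  have hq : ∀ s ∈ Set.Icc a b, HasDerivWithinAt (fun s => Real.exp (κ * s) *
      (Real.log (m s x / π x) - Real.log (m s z / π z) + drift κ g s x - drift κ g s z))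
      0 (Set.Ici 0) s := by
    intro s hs
    have hs0 := ha.trans hs.1
    have hE := (((hasDerivAt_id s).const_mul κ).exp).hasDerivWithinAt (s := Set.Ici 0)
    refine (hE.mul ((((hx.hasDerivWithinAt_log hπ hs0 (hxpos s hs)).sub
      (hz.hasDerivWithinAt_log hπ hs0 (hzpos s hs))).add
      (hasDerivAt_drift κ (hc x) s).hasDerivWithinAt).sub
      (hasDerivAt_drift κ (hc z) s).hasDerivWithinAt)).congr_deriv ?_
    simp only [rate, ← hκ_def, id, hgD s hs0, Pi.sub_apply, Pi.add_apply]
    ring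
  exact constant_of_has_deriv_right_zero
    (fun s hs => (hq s hs).continuousWithinAt.mono fun r hr => ha.trans hr.1)
    (fun s hs => (hq s ⟨hs.1, hs.2.le⟩).mono fun r hr => (ha.trans hs.1).trans hr)
    b ⟨hab, le_rfl⟩

theorem SolvesAt.eq_zero {x z : Space d} (hx : SolvesAt D σ π m x)
    (hz : SolvesAt D σ π m z) (hσ : 0 < σ) (hDC : ∀ m x, |D m x| ≤ C) (hπ : ∀ x, 0 < π x)
    {g : ℝ → Space d → ℝ} (hg : IsBoundedField C g) (hc : ∀ x, Continuous (fun s => g s x))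
    (hgD : ∀ t, 0 ≤ t → ∀ x, g t x = D (m t).toMeasure x) (hz0 : 0 < m 0 z) (hx0 : m 0 x = 0)
    {t : ℝ} (ht : 0 ≤ t) : m t x = 0 := by
  by_contra hne
  have hpos : 0 < m t x := lt_of_le_of_ne ((m t).nonneg x) (Ne.symm hne)
  have hκ : 0 < σ ^ 2 / 2 := by positivity
  have hzpos : ∀ s, 0 ≤ s → 0 < m s z := fun s hs => hz.pos hσ hDC hπ hz0 hs
  obtain ⟨u, hu, humin⟩ := isCompact_Icc.exists_isMinOn (Set.nonempty_Icc.2 ht)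
    (hz.continuousOn.mono fun s (hs : s ∈ Set.Icc 0 t) => hs.1)
  set κ := σ ^ 2 / 2
  set Q := Real.exp (κ * t) * (Real.log (m t x / π x) - Real.log (m t z / π z) +
    drift κ g t x - drift κ g t z) with hQ
  have := pos_of_forall_le_backward
    (δ := Real.exp (Real.log (m u z / π z) - |Q| - 2 * (C / κ)) * π x)
    (hx.continuousOn.mono fun s (hs : s ∈ Set.Icc 0 t) => hs.1) hpos
    (mul_pos (Real.exp_pos _) (hπ x)) (fun a ha hapos => ?_) 0 ⟨le_rfl, ht⟩
  · exact this.ne' hx0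
  have h1 := hx.log_sub_log_eq hz hπ hc hgD ha.1 ha.2 hapos
    (fun s hs => hzpos s (ha.1.trans hs.1))
  rw [← hQ] at h1
  have h2 := Real.one_le_exp (mul_nonneg hκ.le ha.1)
  have h3 : -|Q| ≤ Real.log (m a x / π x) - Real.log (m a z / π z) +
      drift κ g a x - drift κ g a z := by
    set y := Real.log (m a x / π x) - Real.log (m a z / π z) + drift κ g a x - drift κ g a z
    have h4 : |y| ≤ |Q| := by
      rw [h1, abs_mul, Real.abs_exp]
      exact le_mul_of_one_le_left (abs_nonneg _) h2
    exact (neg_le_neg h4).trans (neg_abs_le y)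
  have h4 : Real.log (m u z / π z) ≤ Real.log (m a z / π z) :=
    Real.log_le_log (div_pos (hzpos u hu.1) (hπ z))
      (div_le_div_of_nonneg_right (humin ha) (hπ z).le)
  have h5 := abs_le.1 (hg.abs_drift_le hκ ha.1 x)
  have h6 := abs_le.1 (hg.abs_drift_le hκ ha.1 z)
  rw [← le_div_iff₀ (hπ x), ← Real.le_log_iff_exp_le
    (div_pos (hapos a ⟨le_rfl, ha.2⟩) (hπ x))]
  linarith [h5.2, h6.1]

theorem SolvesAt.eq_mul_weight {m₀ : ProbDensity d} {x z : Space d} (hx : SolvesAt D σ π m x)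
    (hz : SolvesAt D σ π m z) (hσ : 0 < σ) (hDC : ∀ m x, |D m x| ≤ C) (hπ : ∀ x, 0 < π x)
    {g : ℝ → Space d → ℝ} (hg : IsBoundedField C g) (hc : ∀ x, Continuous (fun s => g s x))
    (hgD : ∀ t, 0 ≤ t → ∀ x, g t x = D (m t).toMeasure x) (hz0 : 0 < m 0 z)
    (hmx : m 0 x = m₀ x) (hmz : m 0 z = m₀ z) {t : ℝ} (ht : 0 ≤ t) :
    m t x = m t z / weight (σ ^ 2 / 2) π m₀ g t z * weight (σ ^ 2 / 2) π m₀ g t x := by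
  rcases (m₀.nonneg x).eq_or_lt with h | h
  · rw [hx.eq_zero hz hσ hDC hπ hg hc hgD hz0 (hmx.trans h.symm) ht,
      weight_eq_zero h.symm, mul_zero]
  have hx0 : 0 < m 0 x := hmx ▸ h
  have hpx : ∀ s, 0 ≤ s → 0 < m s x := fun s hs => hx.pos hσ hDC hπ hx0 hs
  have hpz : ∀ s, 0 ≤ s → 0 < m s z := fun s hs => hz.pos hσ hDC hπ hz0 hs
  have h1 := hx.log_sub_log_eq hz hπ hc hgD le_rfl ht (fun s hs => hpx s hs.1)
    (fun s hs => hpz s hs.1)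
  have hz0' := hz0
  rw [hmz] at hz0'
  set κ := σ ^ 2 / 2
  have d0 : ∀ y, drift κ g 0 y = 0 := fun y => by simp [drift]
  rw [d0, d0, hmx, hmz] at h1
  have hwx := weight_pos (κ := κ) (g := g) hπ h t
  have hwz := weight_pos (κ := κ) (g := g) hπ hz0' t
  have h2 : Real.log (m t x / π x) - Real.log (m t z / π z) =
      Real.log (weight κ π m₀ g t x / π x) - Real.log (weight κ π m₀ g t z / π z) := by
    rw [log_weight_div hπ h, log_weight_div hπ hz0']
    have h3 : Real.exp (-(κ * t)) * Real.exp (κ * t) = 1 := by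
      rw [← Real.exp_add]; simp
    have h4 := congrArg (fun y => Real.exp (-(κ * t)) * y) h1
    simp only [← mul_assoc, h3, one_mul, mul_zero, Real.exp_zero] at h4
    linarith
  have px := hπ x
  have pz := hπ z
  rw [Real.log_div (hpx t ht).ne' px.ne', Real.log_div (hpz t ht).ne' pz.ne',
    Real.log_div hwx.ne' px.ne', Real.log_div hwz.ne' pz.ne'] at h2
  refine Real.log_injOn_pos (Set.mem_Ioi.2 (hpx t ht))
    (Set.mem_Ioi.2 (mul_pos (div_pos (hpz t ht) hwz) hwx)) ?_
  rw [Real.log_mul (div_pos (hpz t ht) hwz).ne' hwx.ne', Real.log_div (hpz t ht).ne' hwz.ne']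
  linarith

/-- Every solution is the flow generated by the field that it sees. -/
theorem toMeasure_eq_flow {F : ProbabilityMeasure (Space d) → ℝ} {m₀ : ProbDensity d} {R : ℝ}
    (hσ : 0 < σ) (hD : IsFlatDeriv F D) (hDC : ∀ m x, |D m x| ≤ C) (hπ : ∀ x, 0 < π x)
    (hR : 1 ≤ R) (hm₀ : ∀ x, m₀ x / π x ≤ R) (h0 : (m 0).toMeasure = m₀.toMeasure)
    (hsol : ∀ᵐ x ∂(volume : Measure (Space d)), SolvesAt D σ π m x) :
    ∃ g, IsBoundedField C g ∧ (∀ t x, picard D (σ ^ 2 / 2) π m₀ g t x = g t x) ∧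
      ∀ t, 0 ≤ t → (m t).toMeasure = (flow (σ ^ 2 / 2) π m₀ g t).toMeasure := by
  have hκ : 0 < σ ^ 2 / 2 := by positivity
  have hcont : Continuous (fun t => (m (max t 0)).toMeasure) := by
    refine ProbDensity.continuous_toMeasure (m := fun t => m (max t 0)) ?_
    filter_upwards [hsol] with x hx
    exact hx.continuousOn.comp_continuous (by fun_prop) fun t => le_max_right t 0
  let g : ℝ → Space d → ℝ := fun t x => D (m (max t 0)).toMeasure x
  have hg : IsBoundedField C g := hD.isBoundedField hDC hcont
  have hc : ∀ x, Continuous (fun s => g s x) := fun x => (hD.continuous x).comp hcont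
  have hgD : ∀ t, 0 ≤ t → ∀ x, g t x = D (m t).toMeasure x := by
    intro t ht x
    simp only [g, max_eq_left ht]
  have hgood := hsol.and (ProbDensity.ae_eq_of_toMeasure_eq h0)
  obtain ⟨z, ⟨hz, hmz⟩, hz0⟩ := (m 0).exists_pos hgood
  have hflow : ∀ t, 0 ≤ t → (m t).toMeasure = (flow (σ ^ 2 / 2) π m₀ g t).toMeasure := by
    intro t ht
    apply ProbDensity.toMeasure_eq_of_ae
    have heq : ∀ᵐ x, m t x = m t z / weight (σ ^ 2 / 2) π m₀ g t z *
        weight (σ ^ 2 / 2) π m₀ g t x := by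
      filter_upwards [hgood] with x hx
      exact hx.1.eq_mul_weight hz hσ hDC hπ hg hc hgD hz0 hx.2 hmz ht
    have hone := (m t).integral_eq_one
    rw [integral_congr_ae heq, integral_const_mul] at hone
    filter_upwards [heq] with x hx
    rw [hx, flow_apply hg hκ hπ hR hm₀ ht, eq_div_iff (integral_weight_pos hg hκ hπ hR hm₀ ht).ne',
      mul_right_comm, hone, one_mul]
  refine ⟨g, hg, fun t x => ?_, hflow⟩
  rw [picard, ← flow_max, ← hflow _ (le_max_right t 0)]

end Uniqueness

end BirthDeath

theorem mainTheorem3 {d : ℕ}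
    (F : MeasureTheory.ProbabilityMeasure (BirthDeath.Space d) → ℝ)
    (D : MeasureTheory.ProbabilityMeasure (BirthDeath.Space d) → BirthDeath.Space d → ℝ)
    (D₂ : MeasureTheory.ProbabilityMeasure (BirthDeath.Space d) →
      BirthDeath.Space d → BirthDeath.Space d → ℝ)
    (C C₂ σ R : ℝ) (U : BirthDeath.Space d → ℝ) (π m₀ : BirthDeath.ProbDensity d)
    (hσ : 0 < σ)
    -- `D` is the first flat derivative of `F`, normalised; `D₂` is a second flat derivative
    (hD : BirthDeath.IsFlatDeriv F D)
    (hD_norm : ∀ m : MeasureTheory.ProbabilityMeasure (BirthDeath.Space d),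
      ∫ x, D m x ∂(m : MeasureTheory.Measure (BirthDeath.Space d)) = 0)
    (hD₂ : ∀ x, BirthDeath.IsFlatDeriv (fun m => D m x) (fun m y => D₂ m x y))
    -- `F` is convex
    (hF : ∀ m m' : MeasureTheory.ProbabilityMeasure (BirthDeath.Space d),
      F m - F m' ≤ (∫ x, D m x ∂(m : MeasureTheory.Measure (BirthDeath.Space d))) -
        ∫ x, D m x ∂(m' : MeasureTheory.Measure (BirthDeath.Space d)))
    -- the flat derivatives are bounded
    (hC : 0 < C) (hDC : ∀ m x, |D m x| ≤ C)
    (hC₂ : 0 < C₂) (hDC₂ : ∀ m x y, |D₂ m x y| ≤ C₂)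
    (hπ : BirthDeath.IsGibbsDensity U π)
    (hR : 1 < R) (hm₀ : ∀ x, m₀ x / π x ≤ R) :
    ∃ m : ℝ → BirthDeath.ProbDensity d,
      -- `m` is a solution
      (m 0 = m₀ ∧ (∀ t, 0 ≤ t → BirthDeath.KL (m t) π ≠ ⊤) ∧
        ∀ x, BirthDeath.SolvesAt D σ π m x) ∧
      -- uniqueness, as a flow of probability measures, even among almost everywhere solutions
      (∀ m' : ℝ → BirthDeath.ProbDensity d,
        (m' 0).toMeasure = m₀.toMeasure →
        (∀ t, 0 ≤ t → BirthDeath.KL (m' t) π ≠ ⊤) →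
        (∀ᵐ x ∂(MeasureTheory.volume : MeasureTheory.Measure (BirthDeath.Space d)),
          BirthDeath.SolvesAt D σ π m' x) →
        ∀ t, 0 ≤ t → (m' t).toMeasure = (m t).toMeasure) ∧
      (∀ t, 0 ≤ t →
        BirthDeath.KL (m t) π ≤ ENNReal.ofReal (2 * Real.log R + 4 * C / σ ^ 2)) ∧
      (∃ R₁ : ℝ, 1 < R₁ ∧ ∀ t, 0 ≤ t → ∀ x, m t x / π x ≤ R₁) ∧
      (∀ r : ℝ, 0 < r → (∀ x, r ≤ m₀ x / π x) →
        ∃ r₁ : ℝ, 0 < r₁ ∧ ∀ t, 0 ≤ t → ∀ x, r₁ ≤ m t x / π x) := by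
  have hκ : 0 < σ ^ 2 / 2 := by positivity
  have hπ₀ := hπ.pos
  obtain ⟨g, hg, hfix⟩ :=
    BirthDeath.exists_picard_fixed hD hDC hD₂ hC₂ hDC₂ hC hκ hπ₀ hR.le hm₀
  have hc : ∀ x, Continuous (fun s => g s x) := fun x => by
    simpa only [hfix] using BirthDeath.continuous_picard hD hg hκ hπ₀ hR.le hm₀ x
  have hCσ : 2 * (C / (σ ^ 2 / 2)) = 4 * C / σ ^ 2 := by
    field_simp
    ring
  refine ⟨BirthDeath.flow (σ ^ 2 / 2) π m₀ g,
    ⟨BirthDeath.flow_zero hg hκ hπ₀ hR.le hm₀,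
      fun t ht => (BirthDeath.KL_flow hg hκ hπ₀ hR.le hm₀ ht).1,
      BirthDeath.solvesAt_flow hD_norm hσ hg hc hfix hπ₀ hR.le hm₀⟩,
    fun m' h0 _ hsol t ht => ?_, fun t ht => ?_,
    ⟨R * Real.exp (2 * (C / (σ ^ 2 / 2))), ?_,
      fun t _ x => BirthDeath.flow_div_le hg hκ hπ₀ hR.le hm₀ t x⟩,
    fun r hr hr₀ => ⟨min r 1 / (R * Real.exp (2 * (C / (σ ^ 2 / 2)))), ?_,
      fun t _ x => BirthDeath.le_flow_div hg hκ hπ₀ hR.le hm₀ hr hr₀ t x⟩⟩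
  · obtain ⟨g', hg', hfix', hflow⟩ :=
      BirthDeath.toMeasure_eq_flow hσ hD hDC hπ₀ hR.le hm₀ h0 hsol
    rw [hflow t ht, BirthDeath.picard_fixed_unique hD₂ hC₂ hDC₂ hg' hg hκ hπ₀ hR.le hm₀ hfix' hfix]
  · refine (BirthDeath.KL_flow_le hg hκ hπ₀ hR.le hm₀ ht).trans (ENNReal.ofReal_le_ofReal ?_)
    rw [hCσ]
    linarith [Real.log_pos hR]
  · exact one_lt_mul_of_lt_of_le hR (Real.one_le_exp (by positivity))
  · exact div_pos (lt_min hr one_pos) (by positivity)
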